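/- All Hilbert spaces are finite-dimensional, $D(\rho,\sigma)=\frac12\|\rho-\sigma\|_1$ is the trace distance, $\rho\approx_\varepsilon\sigma$ means $D(\rho,\sigma)\le\varepsilon$, and for maps $\Phi\approx_\varepsilon\Psi$ means $(\Phi\otimes\mathrm{id}_R)(\psi)\approx_\varepsilon(\Psi\otimes\mathrm{id}_R)(\psi)$ for every reference system $R$ and every input state $\psi$. A delegated quantum computation (DQC) protocol for a client Alice and a server Bob is run as follows. Alice receives an input in a register $A$, with computational basis $\{|x\rangle\}_x$ and $N=\dim\mathcal H_A$, and the channel register $C$ starts in $|0\rangle$. Alice applies a CPTP map to $AC$ (keeping a private memory $M$). Then, for $i=1,\dots,n$, Bob applies a CPTP map $\mathcal F_i$ to $CB$, where $B$ is his register, and Alice applies a CPTP map to $MC$. At the end Alice produces by a CPTP map on $MC$ a register $A$ and a register $\bar A$, measures $\bar A$ with projections $\{P^{\mathrm{ok}},P^{\mathrm{err}}\}$, $P^{\mathrm{err}}=1-P^{\mathrm{ok}}$, and outputs $A$ on outcome ok; on outcome err she deletes $A$ and outputs a state $|\mathrm{err}\rangle$ orthogonal to $\mathcal H_A$. For given server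 maps $\{\mathcal F_i\}$ let $\mathcal Q_{A\bar AB}$ be the map from $AB$ to $A\bar AB$ given by the run up to and including the measurement of $\bar A$ (the sum of the two post-measurement branches), and $\mathcal P_{AB}$ the map from $AB$ to Alice's output and $B$ given by the whole run. Let $\mathcal U$ be the computation that the protocol implements, and suppose that it is a unitary transformation $\rho\mapsto U\rho U^\dagger$ on $A$. Suppose that for all systems $B$ and all server maps $\{\mathcal F_i\}$ the following hold. 1. (Stand-alone $\varepsilon_{\mathrm{bl}}$-blindness.) There is a CPTP map $\mathcal F$ on $B$ with $\operatorname{tr}_A\circ\mathcal P_{AB}\approx_{\varepsilon_{\mathrm{bl}}}\mathcal F\circ\operatorname{tr}_A$. 2. (Stand-alone $\varepsilon_{\mathrm{ver}}$-verifiability.) For all initial states $\psi_{AR_1}\otimes\psi_{R_2B}$ there is a $0\le p\le1$ such that the final state $\rho_{AR_1}$ of Alice's output and $R_1$ satisfies $$\rho_{AR_1}\approx_{\varepsilon_{\mathrm{ver}}}p\,(\mathcal U\otimes\mathrm{id}_{R_1})(\psi_{AR_1})+(1-p)\,|\mathrm{err}\rangle\langle\mathrm{err}|\otimes\psi_{R_1}.$$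 3. ($\varepsilon_{\mathrm{ind}}$-independence of the verification.) There are alternative CPTP maps $\{\mathcal F'_i\}$ on $C\bar BB$, where $\bar B\cong\bar A$ is initially in a fixed state, such that, with $\mathcal Q'_{A\bar A\bar BB}$ the corresponding run up to and including the measurement of $\bar A$, $\operatorname{tr}_A\circ\mathcal Q_{A\bar AB}\approx_{\varepsilon_{\mathrm{ind}}}\operatorname{tr}_{A\bar A}\circ\mathcal Q'_{A\bar A\bar BB}$. Put $\delta=4\sqrt{2\varepsilon_{\mathrm{ver}}}+2\varepsilon_{\mathrm{bl}}+2\varepsilon_{\mathrm{ind}}$. Then the protocol is composably $\delta$-secure for classical inputs and composably $\delta N^2$-secure for arbitrary quantum inputs. Here composable $\varepsilon$-security for a class of inputs means the following. The ideal resource takes $\psi_A$ from Alice and a control bit $b$ from Bob's interface; if $b=1$ it outputs a fixed permitted leak at Bob's interface and then reads a bit $c$. It outputs $|\mathrm{err}\rangle\langle\mathrm{err}|$ to Alice if $b=c=1$, and $\mathcal U(\psi_A)$ otherwise. The protocol is $\varepsilon$-secure if there is a simulator, that is, a system with internal memory that supplies $b$ and $c$ and receives the leak at Bob's interface of the ideal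 resource, and that exchanges messages on $C$ in the same rounds as Alice, such that for every system $R$, every initial state $\psi_{AR}$ in the class and all CPTP maps $\{\mathcal D_i\}$ on $CR$ the following holds: the distinguisher that inputs $A$ and applies $\mathcal D_i$ to the $i$-th message and $R$ ends up with two states of Alice's output and $R$, one from interacting with Alice's protocol and one from interacting with the ideal resource with the simulator, whose trace distance is at most $\varepsilon$. Classical inputs are the states $\psi_{AR}=\sum_x|x\rangle\langle x|\otimes\psi_R^x$ with $\psi_R^x\ge0$; quantum inputs are all states $\psi_{AR}$. -/

import Mathlib

open scoped Kronecker ComplexOrder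

noncomputable section

namespace DQC

/-! ### States, maps and distances

A system is given by the finite type labelling its computational basis; operators on it are
complex matrices over that type, and a composite system is labelled by a product type. -/

/-- Linear maps `L(X) → L(Y)` between operator spaces. -/
abbrev Op (x y : Type) := Matrix x x ℂ →ₗ[ℂ] Matrix y y ℂ

/-- Normalized quantum states. -/
structure State (x : Type) [Fintype x] where
  op : Matrix x x ℂ
  posSemidef : op.PosSemidef
  trace_eq_one : op.trace = 1

/-- `Φ ⊗ id_R`. -/
def amp {x y : Type} (Φ : Op x y) (r : Type) : Op (x × r) (y × r) where
  toFun X := Matrix.of fun i j => Φ (X.submatrix (fun k => (k, i.2)) (fun k => (k, j.2))) i.1 j.1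
  map_add' X Y := by
    ext i j
    simp only [Matrix.of_apply, Matrix.add_apply]
    rw [← Matrix.add_apply, ← map_add]
    rfl
  map_smul' t X := by
    ext i j
    simp only [Matrix.of_apply, Matrix.smul_apply, RingHom.id_apply]
    rw [← Matrix.smul_apply, ← map_smul]
    rfl

/-- Relabelling the basis of a system along a bijection (used to reorder tensor factors). -/
def relabel {x y : Type} (e : x ≃ y) : Op x y :=
  (Matrix.reindexLinearEquiv ℂ ℂ e e).toLinearMap

/-- `id_R ⊗ Φ`. -/
def ampLeft {x y : Type} (r : Type) (Φ : Op x y) : Op (r × x) (r × y) :=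
  relabel (Equiv.prodComm y r) ∘ₗ amp Φ r ∘ₗ relabel (Equiv.prodComm r x)

/-- CPTP maps: `Φ ⊗ id_k` preserves positive semidefiniteness for every `k`, and `Φ` preserves
the trace. -/
structure Channel (x y : Type) [Fintype x] [Fintype y] where
  map : Op x y
  completely_positive : ∀ (k : ℕ) (X : Matrix (x × Fin k) (x × Fin k) ℂ),
    X.PosSemidef → (amp map (Fin k) X).PosSemidef
  trace_preserving : ∀ X : Matrix x x ℂ, (map X).trace = X.trace

/-- `X ↦ K X K†`. -/
def conj {x y : Type} [Fintype x] (K : Matrix y x ℂ) : Op x y where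
  toFun X := K * X * K.conjTranspose
  map_add' X Y := by rw [Matrix.mul_add, Matrix.add_mul]
  map_smul' t X := by simp

/-- `X ↦ X ⊗ ω`: adjoin a system in the state `ω` on the right. -/
def attach {x y : Type} (ω : Matrix y y ℂ) : Op x (x × y) where
  toFun X := X ⊗ₖ ω
  map_add' X Y := Matrix.add_kronecker X Y ω
  map_smul' t X := Matrix.smul_kronecker t X ω

/-- `X ↦ ω ⊗ X`: adjoin a system in the state `ω` on the left. -/
def prepend {x y : Type} (ω : Matrix y y ℂ) : Op x (y × x) where
  toFun X := ω ⊗ₖ X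
  map_add' X Y := Matrix.kronecker_add ω X Y
  map_smul' t X := Matrix.kronecker_smul t ω X

/-- The map `X ↦ tr(X) ω`: discard the system and prepare `ω`. -/
def replaceBy {x y : Type} [Fintype x] (ω : Matrix y y ℂ) : Op x y where
  toFun X := X.trace • ω
  map_add' X Y := by rw [Matrix.trace_add, add_smul]
  map_smul' t X := by rw [Matrix.trace_smul, smul_assoc]; rfl

/-- Partial trace over the left factor. -/
def traceLeft {x y : Type} [Fintype x] : Op (x × y) y where
  toFun X := Matrix.of fun i j => ∑ k, X (k, i) (k, j)
  map_add' X Y := by ext i j; simp [Finset.sum_add_distrib]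
  map_smul' t X := by ext i j; simp [Finset.mul_sum]

/-- Partial trace over the right factor. -/
def traceRight {x y : Type} [Fintype y] : Op (x × y) x where
  toFun X := Matrix.of fun i j => ∑ k, X (i, k) (j, k)
  map_add' X Y := by ext i j; simp [Finset.sum_add_distrib]
  map_smul' t X := by ext i j; simp [Finset.mul_sum]

/-- The trace norm `tr √(A†A)`. -/
def traceNorm {x : Type} [Fintype x] [DecidableEq x] (A : Matrix x x ℂ) : ℝ :=
  (cfc Real.sqrt (A.conjTranspose * A)).trace.re

/-- The trace distance. -/
def traceDist {x : Type} [Fintype x] [DecidableEq x] (ρ σ : Matrix x x ℂ) : ℝ :=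
  traceNorm (ρ - σ) / 2

/-- The diamond distance of `Φ` and `Ψ` is at most `ε`: for every reference system `R` and every
input state on `X ⊗ R` the outputs are `ε`-close in trace distance. -/
def DiamondClose {x y : Type} [Fintype x] [Fintype y] [DecidableEq y]
    (Φ Ψ : Op x y) (ε : ℝ) : Prop :=
  ∀ (r : Type) [Fintype r] [DecidableEq r] (ψ : State (x × r)),
    traceDist (amp Φ r ψ.op) (amp Ψ r ψ.op) ≤ ε

/-! ### The output register with its error flag

Alice's output space is `H_A ⊕ ℂ|err⟩`, with basis `Option a`, where `none` labels `|err⟩`. -/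

/-- The inclusion of the valid outputs. -/
def embed {a : Type} [Fintype a] [DecidableEq a] : Op a (Option a) :=
  conj (Matrix.of fun i j => if i = some j then 1 else 0)

/-- `X ↦ tr(X) |err⟩⟨err|`. -/
def errFlag (x a : Type) [Fintype x] [DecidableEq a] : Op x (Option a) :=
  replaceBy (Matrix.single none none 1)

/-- `X ↦ U X U†`, with values in the valid outputs. -/
def target {a : Type} [Fintype a] [DecidableEq a] (U : Matrix.unitaryGroup a ℂ) :
    Op a (Option a) :=
  embed ∘ₗ conj (U : Matrix a a ℂ)

/-! ### Protocols -/

/-- Alternating interaction over `n` rounds of a party with memory `M` and a party with register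
`B`, through the channel register `C`. In each round the second party acts on `C ⊗ B`, and then
the first party acts on `M ⊗ C`. -/
def interact {n : ℕ} {m c b : Type} [Fintype m] [Fintype c] [Fintype b]
    (S : Fin n → Channel (m × c) (m × c)) (F : Fin n → Channel (c × b) (c × b)) :
    Op ((m × c) × b) ((m × c) × b) :=
  Fin.foldl n (fun Φ i =>
    amp (S i).map b ∘ₗ
      relabel (Equiv.prodAssoc m c b).symm ∘ₗ ampLeft m (F i).map ∘ₗ
        relabel (Equiv.prodAssoc m c b) ∘ₗ Φ) LinearMap.id

/-- The client's side of a DQC protocol in which `n` messages go from the client to the server and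
`n` messages go back. The registers are: `a` Alice's input (and valid output), `c` the channel,
`m` Alice's memory, `v` the register that she measures in order to accept or reject.
The channel starts in the basis state `|start⟩`; Alice applies `first`, then `step i` after the
`i`-th action of Bob, and at the end `last`, which produces the output register and the register
to be measured with the projections `{accept, 1 - accept}`. -/
structure Protocol (n : ℕ) (a c m v : Type) [Fintype a] [Fintype c] [Fintype m] [Fintype v]
    [DecidableEq v] where
  start : c
  first : Channel (a × c) (m × c)
  step : Fin n → Channel (m × c) (m × c)
  last : Channel (m × c) (a × v)
  accept : Matrix v v ℂ
  isProjection : IsStarProjection accept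

section

variable {n : ℕ} {a c m v b : Type} [Fintype a] [Fintype c] [Fintype m] [Fintype v] [Fintype b]
  [DecidableEq a] [DecidableEq c] [DecidableEq v]

/-- The projection `X ↦ (1 ⊗ P) X (1 ⊗ P)` of the measured register. -/
def branch (P : Matrix v v ℂ) : Op (a × v) (a × v) :=
  conj ((1 : Matrix a a ℂ) ⊗ₖ P)

/-- The run of the protocol, against a server applying the maps `F i` to `C ⊗ B`, up to and
including Alice's measurement of her verification register:
`φ = P_ok φ' P_ok + P_err φ' P_err`. -/
def Protocol.measured (π : Protocol n a c m v) (F : Fin n → Channel (c × b) (c × b)) :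
    Op (a × b) ((a × v) × b) :=
  amp (branch π.accept + branch (1 - π.accept)) b ∘ₗ
    amp π.last.map b ∘ₗ interact π.step F ∘ₗ amp π.first.map b ∘ₗ
      amp (attach (Matrix.single π.start π.start 1)) b

/-- The whole run of the protocol: after the measurement Alice outputs her output register if she
accepts, and otherwise deletes it and outputs the error flag. -/
def Protocol.run (π : Protocol n a c m v) (F : Fin n → Channel (c × b) (c × b)) :
    Op (a × b) (Option a × b) :=
  amp (embed ∘ₗ traceRight ∘ₗ branch π.accept + errFlag (a × v) a ∘ₗ branch (1 - π.accept)) b ∘ₗ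
    π.measured F

/-! ### Stand-alone security -/

/-- Stand-alone `ε`-blindness. -/
def StandAloneBlind (π : Protocol n a c m v) (ε : ℝ) : Prop :=
  ∀ (b : Type) [Fintype b] [DecidableEq b] (F : Fin n → Channel (c × b) (c × b)),
    ∃ G : Channel b b, DiamondClose (traceLeft ∘ₗ π.run F) (G.map ∘ₗ traceLeft) ε

/-- Stand-alone `ε`-verifiability, for the unitary `U`: for an initial state
`ψ_{A R₁} ⊗ ψ_{B R₂}`, the final state of `A R₁` is `ε`-close to a mixture of the correct outcome
and the error flag. -/
def StandAloneVerifiable (π : Protocol n a c m v) (U : Matrix.unitaryGroup a ℂ) (ε : ℝ) : Prop :=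
  ∀ (b : Type) [Fintype b] [DecidableEq b] (F : Fin n → Channel (c × b) (c × b))
    (r₁ r₂ : Type) [Fintype r₁] [DecidableEq r₁] [Fintype r₂] [DecidableEq r₂]
    (ψA : State (a × r₁)) (ψB : State (b × r₂)),
    ∃ p : ℝ, 0 ≤ p ∧ p ≤ 1 ∧
      traceDist
        (traceRight (relabel (Equiv.prodProdProdComm (Option a) b r₁ r₂)
          (amp (π.run F) (r₁ × r₂)
            (relabel (Equiv.prodProdProdComm a r₁ b r₂) (ψA.op ⊗ₖ ψB.op)))))
        ((p : ℂ) • amp (target U) r₁ ψA.op + ((1 - p : ℝ) : ℂ) • amp (errFlag a a) r₁ ψA.op) ≤ ε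

/-- Stand-alone `ε'`-independent `ε`-verifiability: the server could have generated a copy of
Alice's measured register by himself, with alternative maps that act also on an additional
register of the same dimension, which is initially in a fixed state. -/
def StandAloneIndependentVerifiable (π : Protocol n a c m v) (U : Matrix.unitaryGroup a ℂ)
    (ε' ε : ℝ) : Prop :=
  StandAloneVerifiable π U ε ∧
  ∀ (b : Type) [Fintype b] [DecidableEq b] (F : Fin n → Channel (c × b) (c × b)),
    ∃ (β : State v) (F' : Fin n → Channel (c × (v × b)) (c × (v × b))),
      DiamondClose
        (traceLeft ∘ₗ relabel (Equiv.prodAssoc a v b) ∘ₗ π.measured F)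
        (traceLeft ∘ₗ π.measured F' ∘ₗ ampLeft a (prepend β.op)) ε'

end

/-! ### The ideal resource, simulators and composable security -/

/-- First stage of the ideal resource: the control bit `b` is read (measured in the
computational basis); if it is `1`, the permitted leak is output at Bob's interface, and otherwise
nothing (`none`). The bit is kept for the second stage. -/
def leakStage {ℓ : Type} [DecidableEq ℓ] (leak : ℓ) : Op Bool (Bool × Option ℓ) :=
  ∑ bit : Bool, conj (Matrix.single (bit, if bit then some leak else none) bit 1)

/-- Second stage of the ideal resource: it holds Alice's input and the bit `b`, and reads the bit
`c`; it outputs the error flag if `b = c = 1`, and the correct result otherwise. -/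
def outputStage {a : Type} [Fintype a] [DecidableEq a] (U : Matrix.unitaryGroup a ℂ) :
    Op (a × (Bool × Bool)) (Option a) :=
  ∑ bits : Bool × Bool,
    (if bits.1 && bits.2 then errFlag a a else target U) ∘ₗ
      (conj (Matrix.of fun i j => if j = (i, bits) then 1 else 0) : Op (a × (Bool × Bool)) a)

/-- A simulator with memory `s`, plugged into Bob's interface of the ideal resource: it prepares
the control bit `b` together with its memory; it receives the leak and produces the first message
on the channel; it answers the messages that it receives (`step`); after the last message it
computes the bit `c` for the ideal resource. -/
structure Simulator (n : ℕ) (c ℓ s : Type) [Fintype c] [Fintype ℓ] [Fintype s] where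
  prep : State (Bool × s)
  start : Channel (Option ℓ × s) (s × c)
  step : Fin n → Channel (s × c) (s × c)
  finish : Channel (s × c) Bool

section

variable {n : ℕ} {a c m v ℓ s r : Type} [Fintype a] [Fintype c] [Fintype m] [Fintype v]
  [Fintype ℓ] [Fintype s] [Fintype r] [DecidableEq a] [DecidableEq c] [DecidableEq v]
  [DecidableEq ℓ]

/-- The joint state of the bit `b`, kept by the ideal resource, the memory of the simulator and its
first message. -/
def Simulator.opening (σ : Simulator n c ℓ s) (leak : ℓ) :
    Matrix (Bool × (s × c)) (Bool × (s × c)) ℂ :=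
  ampLeft Bool σ.start.map
    (relabel (Equiv.prodAssoc Bool (Option ℓ) s) (amp (leakStage leak) s σ.prep.op))

/-- The interaction of a distinguisher with the ideal resource and the simulator. The distinguisher
prepares a state on `A ⊗ R`, gives `A` to the resource, and applies `D i` to `C ⊗ R` whenever it
gets a message; the result is the final state of Alice's output and `R`. -/
def idealRun (U : Matrix.unitaryGroup a ℂ) (leak : ℓ) (σ : Simulator n c ℓ s)
    (D : Fin n → Channel (c × r) (c × r)) : Op (a × r) (Option a × r) :=
  let e₁ : (a × r) × (Bool × (s × c)) ≃ ((s × c) × r) × (a × Bool) :=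
    { toFun := fun i => ((i.2.2, i.1.2), (i.1.1, i.2.1))
      invFun := fun j => ((j.2.1, j.1.2), (j.2.2, j.1.1))
      left_inv := fun _ => rfl
      right_inv := fun _ => rfl }
  let e₂ : (Bool × r) × (a × Bool) ≃ (a × (Bool × Bool)) × r :=
    { toFun := fun i => ((i.2.1, (i.2.2, i.1.1)), i.1.2)
      invFun := fun j => ((j.1.2.2, j.2), (j.1.1, j.1.2.1))
      left_inv := fun _ => rfl
      right_inv := fun _ => rfl }
  amp (outputStage U) r ∘ₗ relabel e₂ ∘ₗ amp (amp σ.finish.map r) (a × Bool) ∘ₗ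
    amp (interact σ.step D) (a × Bool) ∘ₗ relabel e₁ ∘ₗ attach (σ.opening leak)

/-- Composable `ε`-security for a class of initial states: there is a simulator such that every
distinguisher, preparing an initial state of the class on `A ⊗ R` and applying arbitrary maps to
the messages and `R`, ends up with `ε`-close states when it interacts with the client's protocol
and when it interacts with the ideal resource and the simulator. -/
def SecureFor (inputs : (r : Type) → Matrix (a × r) (a × r) ℂ → Prop)
    (π : Protocol n a c m v) (U : Matrix.unitaryGroup a ℂ) (leak : ℓ) (ε : ℝ) : Prop :=
  ∃ (s : Type) (_ : Fintype s) (σ : Simulator n c ℓ s),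
    ∀ (r : Type) [Fintype r] [DecidableEq r] (D : Fin n → Channel (c × r) (c × r))
      (ψ : State (a × r)), inputs r ψ.op →
      traceDist (π.run D ψ.op) (idealRun U leak σ D ψ.op) ≤ ε

end

/-- Arbitrary quantum inputs. -/
def quantumInput {a : Type} (r : Type) (_ : Matrix (a × r) (a × r) ℂ) : Prop := True

/-- Classical inputs: the state on `A ⊗ R` is of the form `∑ₓ |x⟩⟨x| ⊗ ψₓ`. -/
def classicalInput {a : Type} (r : Type) (ψ : Matrix (a × r) (a × r) ℂ) : Prop :=
  ∀ i j : a × r, i.1 ≠ j.1 → ψ i j = 0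

end DQC

end

set_option linter.unusedSectionVars false

noncomputable section

namespace DQC

/-! ### The trace norm of Hermitian matrices -/

section

variable {x : Type} [Fintype x]

/-! The simulator runs Alice's own protocol on a dummy input, always sets `b = 1`, and sends its
verdict as `c`. The proof shows that a real run can be rebuilt, up to a small error, from the joint
state of the verdict and the server's register (`Protocol.statistic`), and that this statistic
hardly depends on Alice's input.

Rebuilding: for a pure input on `A R₁`, uncorrelated with `B R₂`, the correct output is a rank-one
projection `T`, because the computation is unitary. Let `Q` be the projection on the valid outputs
orthogonal to `T`. Both terms of the verifiability mixture vanish under `Q`, so the final state has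
weight at most `2 εver` there. `gentle_measurement` then says that the accepted branch is within `4
√(2 εver)` in trace norm of `T` tensored with its marginal on `B R₂`. A rejected run carries only
the error flag. So the state is close to `assemble T` of the statistic (`assemble_verdict`).

Independence of the input: the alternative server of the independence condition holds a copy of the
verification register, and blindness applied to this enlarged server says that what it holds does
not depend on the input (`statistic_close`). Replacing the input by the dummy turns the assembled
state into exactly the ideal run (`assemble_simulated`). Together this is `run_close_pure`.

Correlated inputs: a classical input is a mixture of products of basis states with server states, so
nothing is lost. A quantum input is obtained by teleportation: put half of a maximally entangled
pair into the protocol and postselect on a maximally entangled projection of the references. Its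
success probability is `1 / N²`, whence the factor `N²`. -/

theorem trace_re_nonneg {A : Matrix x x ℂ} (hA : A.PosSemidef) : 0 ≤ A.trace.re :=
  (Complex.le_def.1 hA.trace_nonneg).1

theorem trace_eq_re {A : Matrix x x ℂ} (hA : A.PosSemidef) : A.trace = (A.trace.re : ℂ) :=
  Complex.ext rfl (by simpa using (Complex.le_def.1 hA.trace_nonneg).2.symm)

theorem trace_mul_re_nonneg {A B : Matrix x x ℂ} (hA : A.PosSemidef) (hB : B.PosSemidef) :
    0 ≤ (A * B).trace.re := by
  classical
  open scoped MatrixOrder in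
  obtain ⟨C, rfl⟩ := CStarAlgebra.nonneg_iff_eq_star_mul_self.1 hB.nonneg
  rw [← mul_assoc, Matrix.trace_mul_comm, ← mul_assoc]
  exact trace_re_nonneg (hA.mul_mul_conjTranspose_same C)

variable [DecidableEq x]

theorem cfc_posSemidef (A : Matrix x x ℂ) {f : ℝ → ℝ} (hf : ∀ t, 0 ≤ f t) :
    (cfc f A).PosSemidef := by
  open scoped MatrixOrder in
  exact Matrix.nonneg_iff_posSemidef.1 (cfc_nonneg fun t _ => hf t)

/-- The spectrum is finite, so even discontinuous functions, such as the sign used below, are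
admissible in the functional calculus. -/
theorem continuousOn_spectrum (A : Matrix x x ℂ) (f : ℝ → ℝ) :
    ContinuousOn f (spectrum ℝ A) :=
  (Matrix.finite_real_spectrum (A := A)).continuousOn f

theorem traceNorm_eq_abs {A : Matrix x x ℂ} (hA : A.IsHermitian) :
    traceNorm A = (cfc (fun t : ℝ => |t|) A).trace.re := by
  have hs : IsSelfAdjoint A := hA
  unfold traceNorm
  rw [hA.eq, ← pow_two, ← cfc_pow_id (R := ℝ) A 2,
    ← cfc_comp' Real.sqrt (fun t : ℝ => t ^ 2) A]
  · simp only [Real.sqrt_sq_eq_abs]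

/-- The Jordan decomposition attains the trace norm. -/
theorem exists_decomposition {A : Matrix x x ℂ} (hA : A.IsHermitian) :
    ∃ P Q : Matrix x x ℂ, P.PosSemidef ∧ Q.PosSemidef ∧ A = P - Q ∧
      P.trace.re + Q.trace.re = traceNorm A := by
  have hs : IsSelfAdjoint A := hA
  refine ⟨cfc (fun t : ℝ => max t 0) A, cfc (fun t : ℝ => max (-t) 0) A,
    cfc_posSemidef A fun t => le_max_right _ _, cfc_posSemidef A fun t => le_max_right _ _, ?_, ?_⟩
  · rw [← cfc_sub _ _ A (continuousOn_spectrum A _) (continuousOn_spectrum A _)]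
    conv_lhs => rw [← cfc_id ℝ A]
    congr 1
    ext t
    rcases le_total t 0 with h | h <;> simp [h]
  · rw [traceNorm_eq_abs hA, ← Complex.add_re, ← Matrix.trace_add,
      ← cfc_add _ _ _ (continuousOn_spectrum A _) (continuousOn_spectrum A _)]
    congr 3
    ext t
    rcases le_total t 0 with h | h <;> simp [h, abs_of_nonneg, abs_of_nonpos]

/-- Duality: `|A| = sgn(A) A` and `-1 ≤ sgn(A) ≤ 1`, so pairing the sign with `P` and with `-Q`
gives at most the two traces. With `exists_decomposition` this makes the trace norm a minimum over
decompositions, and the later norm bounds are proved by exhibiting one. -/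
theorem traceNorm_sub_le {P Q : Matrix x x ℂ} (hP : P.PosSemidef) (hQ : Q.PosSemidef) :
    traceNorm (P - Q) ≤ P.trace.re + Q.trace.re := by
  have hA : (P - Q).IsHermitian := hP.isHermitian.sub hQ.isHermitian
  set A := P - Q with hdef
  have hs : IsSelfAdjoint A := hA
  -- The value at `0` plays no role in `f t * t = |t|`; it only has to lie in `[-1, 1]`.
  let f : ℝ → ℝ := fun t => if 0 ≤ t then 1 else -1
  have hc := continuousOn_spectrum A
  have habs : cfc (fun t : ℝ => |t|) A = cfc f A * A := by
    calc cfc (fun t : ℝ => |t|) A = cfc (fun t => f t * t) A := by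
          congr 1
          ext t
          by_cases h : 0 ≤ t
          · simp [f, h, abs_of_nonneg]
          · simp [f, h, abs_of_neg (not_le.1 h)]
      _ = cfc f A * cfc (fun t : ℝ => t) A := cfc_mul _ _ _ (hc _) (hc _)
      _ = cfc f A * A := by rw [cfc_id' ℝ A]
  have h1 : (1 - cfc f A).PosSemidef := by
    rw [← cfc_const_one ℝ A, ← cfc_sub _ _ _ (hc _) (hc _)]
    refine cfc_posSemidef A fun t => ?_
    by_cases h : 0 ≤ t <;> simp [f, h]
  have h2 : (1 + cfc f A).PosSemidef := by
    rw [← cfc_const_one ℝ A, ← cfc_add _ _ _ (hc _) (hc _)]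
    refine cfc_posSemidef A fun t => ?_
    by_cases h : 0 ≤ t <;> simp [f, h]
  have h3 := trace_mul_re_nonneg h1 hP
  have h4 := trace_mul_re_nonneg h2 hQ
  rw [traceNorm_eq_abs hA, habs, hdef, mul_sub]
  simp only [sub_mul, add_mul, one_mul, Matrix.trace_sub, Matrix.trace_add, Complex.sub_re,
    Complex.add_re] at h3 h4 ⊢
  linarith

theorem traceNorm_nonneg {A : Matrix x x ℂ} (hA : A.IsHermitian) : 0 ≤ traceNorm A := by
  obtain ⟨P, Q, hP, hQ, -, h⟩ := exists_decomposition hA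
  have := trace_re_nonneg hP
  have := trace_re_nonneg hQ
  linarith

theorem traceNorm_add_le {A B : Matrix x x ℂ} (hA : A.IsHermitian) (hB : B.IsHermitian) :
    traceNorm (A + B) ≤ traceNorm A + traceNorm B := by
  obtain ⟨P, Q, hP, hQ, rfl, h⟩ := exists_decomposition hA
  obtain ⟨P', Q', hP', hQ', rfl, h'⟩ := exists_decomposition hB
  rw [← h, ← h', sub_add_sub_comm]
  refine (traceNorm_sub_le (hP.add hP') (hQ.add hQ')).trans_eq ?_
  simp only [Matrix.trace_add, Complex.add_re]
  ring

theorem traceNorm_zero : traceNorm (0 : Matrix x x ℂ) = 0 := by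
  have h := traceNorm_sub_le (Matrix.PosSemidef.zero (n := x) (R := ℂ)) Matrix.PosSemidef.zero
  have h' := traceNorm_nonneg (Matrix.isHermitian_zero (n := x) (α := ℂ))
  simp at h
  linarith

theorem traceNorm_sum_le {ι : Type} (s : Finset ι) (A : ι → Matrix x x ℂ)
    (hA : ∀ i, (A i).IsHermitian) :
    traceNorm (∑ i ∈ s, A i) ≤ ∑ i ∈ s, traceNorm (A i) := by
  classical
  induction s using Finset.induction_on with
  | empty => simp [traceNorm_zero]
  | insert i s hi ih =>
    rw [Finset.sum_insert hi, Finset.sum_insert hi]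
    refine (traceNorm_add_le (hA i) ?_).trans (by gcongr)
    exact Finset.sum_induction _ Matrix.IsHermitian (fun _ _ h h' => h.add h')
      Matrix.isHermitian_zero (fun j _ => hA j)

theorem traceNorm_smul_le {A : Matrix x x ℂ} (hA : A.IsHermitian) {t : ℝ} (ht : 0 ≤ t) :
    traceNorm ((t : ℂ) • A) ≤ t * traceNorm A := by
  obtain ⟨P, Q, hP, hQ, rfl, h⟩ := exists_decomposition hA
  have ht' : (0 : ℂ) ≤ t := by exact_mod_cast ht
  rw [← h, smul_sub]
  refine (traceNorm_sub_le (hP.smul ht') (hQ.smul ht')).trans_eq ?_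
  simp [Matrix.trace_smul]
  ring

/-- The trace norm decreases under positive maps that do not increase the trace. -/
theorem traceNorm_map_le {y : Type} [Fintype y] [DecidableEq y] (Φ : Op x y)
    (hΦ : ∀ X : Matrix x x ℂ, X.PosSemidef → (Φ X).PosSemidef)
    (htr : ∀ X : Matrix x x ℂ, X.PosSemidef → (Φ X).trace.re ≤ X.trace.re)
    {A : Matrix x x ℂ} (hA : A.IsHermitian) : traceNorm (Φ A) ≤ traceNorm A := by
  obtain ⟨P, Q, hP, hQ, rfl, h⟩ := exists_decomposition hA
  rw [← h, map_sub]
  exact (traceNorm_sub_le (hΦ P hP) (hΦ Q hQ)).trans (add_le_add (htr P hP) (htr Q hQ))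

/-- Effects distinguish no better than the trace norm. -/
theorem trace_effect_le {E A : Matrix x x ℂ} (hE : E.PosSemidef) (hE' : (1 - E).PosSemidef)
    (hA : A.IsHermitian) : (E * A).trace.re ≤ traceNorm A := by
  obtain ⟨P, Q, hP, hQ, rfl, h⟩ := exists_decomposition hA
  have h1 := trace_mul_re_nonneg hE hQ
  have h2 := trace_mul_re_nonneg hE' hP
  have h3 := trace_re_nonneg hQ
  rw [← h, mul_sub]
  simp only [sub_mul, one_mul, Matrix.trace_sub, Complex.sub_re] at h2 ⊢
  linarith

theorem traceDist_triangle {A B C : Matrix x x ℂ} (hA : A.IsHermitian) (hB : B.IsHermitian)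
    (hC : C.IsHermitian) : traceDist A C ≤ traceDist A B + traceDist B C := by
  have := traceNorm_add_le (hA.sub hB) (hB.sub hC)
  rw [sub_add_sub_cancel] at this
  unfold traceDist
  linarith

theorem traceDist_comm {A B : Matrix x x ℂ} (hA : A.IsHermitian) (hB : B.IsHermitian) :
    traceDist A B = traceDist B A := by
  have key : ∀ {A B : Matrix x x ℂ}, A.IsHermitian → B.IsHermitian →
      traceNorm (A - B) ≤ traceNorm (B - A) := by
    intro A B hA hB
    obtain ⟨P, Q, hP, hQ, h, h'⟩ := exists_decomposition (hB.sub hA)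
    rw [← h', ← neg_sub, h, neg_sub, add_comm]
    exact traceNorm_sub_le hQ hP
  unfold traceDist
  rw [le_antisymm (key hA hB) (key hB hA)]

end

/-! ### Completely positive and trace-preserving maps -/

/-- Complete positivity. -/
def IsCP {x y : Type} (Φ : Op x y) : Prop :=
  ∀ (r : Type) [Fintype r] (X : Matrix (x × r) (x × r) ℂ), X.PosSemidef → (amp Φ r X).PosSemidef

/-- Trace preservation. -/
def IsTP {x y : Type} [Fintype x] [Fintype y] (Φ : Op x y) : Prop :=
  ∀ X : Matrix x x ℂ, (Φ X).trace = X.trace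

section

variable {x y z r : Type}

theorem amp_comp (Φ : Op y z) (Ψ : Op x y) (r : Type) : amp (Φ ∘ₗ Ψ) r = amp Φ r ∘ₗ amp Ψ r := rfl

theorem amp_kronecker (Φ : Op x y) (X : Matrix x x ℂ) (Y : Matrix r r ℂ) :
    amp Φ r (X ⊗ₖ Y) = Φ X ⊗ₖ Y := by
  ext i j
  have h : (X ⊗ₖ Y).submatrix (fun k => (k, i.2)) (fun k => (k, j.2)) = Y i.2 j.2 • X := by
    ext k l
    simp [mul_comm]
  change Φ ((X ⊗ₖ Y).submatrix (fun k => (k, i.2)) (fun k => (k, j.2))) i.1 j.1 = _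
  rw [h, map_smul]
  simp [mul_comm]

theorem IsCP.pos {Φ : Op x y} (h : IsCP Φ) {X : Matrix x x ℂ} (hX : X.PosSemidef) :
    (Φ X).PosSemidef :=
  (h Unit (X.submatrix Prod.fst Prod.fst) (hX.submatrix _)).submatrix fun i => (i, ())

theorem IsCP.comp {Φ : Op y z} {Ψ : Op x y} (h : IsCP Φ) (h' : IsCP Ψ) : IsCP (Φ ∘ₗ Ψ) :=
  fun r _ X hX => h r _ (h' r X hX)

theorem IsCP.add {Φ Ψ : Op x y} (h : IsCP Φ) (h' : IsCP Ψ) : IsCP (Φ + Ψ) :=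
  fun r _ X hX => (h r X hX).add (h' r X hX)

theorem IsCP.relabel (e : x ≃ y) : IsCP (relabel e) :=
  fun r _ _ hX => hX.submatrix fun i : y × r => (e.symm i.1, i.2)

theorem IsCP.amp {Φ : Op x y} (h : IsCP Φ) (r : Type) [Fintype r] : IsCP (amp Φ r) :=
  fun q _ X hX => (h (r × q) (X.submatrix (Equiv.prodAssoc x r q).symm (Equiv.prodAssoc x r q).symm)
    (hX.submatrix _)).submatrix (Equiv.prodAssoc y r q)

theorem IsCP.ampLeft {Φ : Op x y} (h : IsCP Φ) (r : Type) [Fintype r] : IsCP (ampLeft r Φ) :=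
  (IsCP.relabel _).comp ((h.amp r).comp (IsCP.relabel _))

theorem IsCP.id : IsCP (LinearMap.id : Op x x) := fun _ _ _ h => h

theorem amp_conj [Fintype x] [Fintype r] [DecidableEq r] (K : Matrix y x ℂ)
    (X : Matrix (x × r) (x × r) ℂ) : amp (conj K) r X = conj (K ⊗ₖ (1 : Matrix r r ℂ)) X := by
  ext i j
  simp [amp, conj, Matrix.mul_apply, Fintype.sum_prod_type, Matrix.one_apply, apply_ite]

theorem conj_pos [Fintype x] [Fintype y] (K : Matrix y x ℂ) {X : Matrix x x ℂ} (hX : X.PosSemidef) :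
    (conj K X).PosSemidef :=
  hX.mul_mul_conjTranspose_same K

theorem IsCP.conj [Fintype x] [Fintype y] (K : Matrix y x ℂ) : IsCP (conj K) := by
  classical
  intro r _ X hX
  rw [amp_conj]
  exact conj_pos _ hX

theorem posSemidef_traceLeft [Fintype x] {X : Matrix (x × y) (x × y) ℂ} (hX : X.PosSemidef) :
    (traceLeft X).PosSemidef := by
  have h : traceLeft X = ∑ k, X.submatrix (fun i => (k, i)) (fun i => (k, i)) := by
    ext i j
    simp [traceLeft, Matrix.sum_apply]
  rw [h]
  exact Matrix.posSemidef_sum _ fun k _ => hX.submatrix _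

theorem IsCP.traceLeft [Fintype x] : IsCP (traceLeft : Op (x × y) y) := by
  intro r _ X hX
  exact posSemidef_traceLeft (hX.submatrix (Equiv.prodAssoc x y r).symm)

theorem traceRight_eq [Fintype y] :
    (traceRight : Op (x × y) x) = DQC.traceLeft ∘ₗ DQC.relabel (Equiv.prodComm x y) := rfl

theorem IsCP.traceRight [Fintype y] : IsCP (traceRight : Op (x × y) x) := by
  rw [traceRight_eq]
  exact IsCP.traceLeft.comp (IsCP.relabel _)

theorem posSemidef_kronecker [Fintype x] [Fintype y] {X : Matrix x x ℂ} {Y : Matrix y y ℂ}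
    (hX : X.PosSemidef) (hY : Y.PosSemidef) : (X ⊗ₖ Y).PosSemidef := by
  classical
  exact hX.kronecker hY

theorem IsCP.attach [Fintype x] [Fintype y] {ω : Matrix y y ℂ} (hω : ω.PosSemidef) :
    IsCP (attach ω : Op x (x × y)) := by
  intro r _ X hX
  exact (posSemidef_kronecker hX hω).submatrix fun i : (x × y) × r => ((i.1.1, i.2), i.1.2)

theorem IsCP.prepend [Fintype x] [Fintype y] {ω : Matrix y y ℂ} (hω : ω.PosSemidef) :
    IsCP (prepend ω : Op x (y × x)) := by
  intro r _ X hX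
  exact (posSemidef_kronecker hω hX).submatrix (Equiv.prodAssoc y x r)

theorem amp_replaceBy [Fintype x] (ω : Matrix y y ℂ) (X : Matrix (x × r) (x × r) ℂ) :
    amp (replaceBy ω) r X = ω ⊗ₖ DQC.traceLeft X := by
  ext i j
  simp [DQC.amp, DQC.replaceBy, DQC.traceLeft, Matrix.trace, mul_comm]

theorem IsCP.replaceBy [Fintype x] [Fintype y] {ω : Matrix y y ℂ} (hω : ω.PosSemidef) :
    IsCP (replaceBy ω : Op x y) := by
  intro r _ X hX
  rw [amp_replaceBy]
  exact posSemidef_kronecker hω (posSemidef_traceLeft hX)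

/-- `Channel` tests positivity only against `Fin k`; an enumeration of `r` carries it to every
finite reference. -/
theorem Channel.isCP [Fintype x] [Fintype y] (Φ : Channel x y) : IsCP Φ.map := by
  intro r _ X hX
  let e := Fintype.equivFin r
  have h := (Φ.completely_positive _ (X.submatrix (fun i => (i.1, e.symm i.2))
    fun i => (i.1, e.symm i.2)) (hX.submatrix _)).submatrix fun i : y × r => (i.1, e i.2)
  convert h using 1
  ext i j
  simp [DQC.amp, Function.comp_def]

section trace

variable [Fintype x] [Fintype y] [Fintype z] [Fintype r]

theorem Channel.isTP (Φ : Channel x y) : IsTP Φ.map := Φ.trace_preserving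

/-- A completely positive and trace-preserving map as a channel. -/
def toChannel (Φ : Op x y) (h : IsCP Φ) (h' : IsTP Φ) : Channel x y :=
  ⟨Φ, fun _ => h _, h'⟩

theorem IsTP.id : IsTP (LinearMap.id : Op x x) := fun _ => rfl

theorem IsTP.comp {Φ : Op y z} {Ψ : Op x y} (h : IsTP Φ) (h' : IsTP Ψ) : IsTP (Φ ∘ₗ Ψ) :=
  fun X => (h _).trans (h' X)

theorem traceLeft_amp {q : Type} {Φ : Op x y} (h : IsTP Φ) (X : Matrix (x × q) (x × q) ℂ) :
    traceLeft (amp Φ q X) = traceLeft X := by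
  ext i j
  exact h (X.submatrix (fun k => (k, i)) (fun k => (k, j)))

theorem trace_traceLeft (X : Matrix (x × y) (x × y) ℂ) : (traceLeft X).trace = X.trace := by
  simp only [Matrix.trace, traceLeft, Fintype.sum_prod_type, Matrix.diag_apply]
  exact Finset.sum_comm

theorem IsTP.traceLeft : IsTP (traceLeft : Op (x × y) y) := trace_traceLeft

theorem IsTP.amp {Φ : Op x y} (h : IsTP Φ) (r : Type) [Fintype r] : IsTP (amp Φ r) := by
  intro X
  rw [← trace_traceLeft, traceLeft_amp h, trace_traceLeft]

theorem IsTP.relabel (e : x ≃ y) : IsTP (relabel e) := by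
  intro X
  exact e.symm.sum_comp fun i => X i i

theorem IsTP.ampLeft {Φ : Op x y} (h : IsTP Φ) (r : Type) [Fintype r] : IsTP (ampLeft r Φ) :=
  (IsTP.relabel _).comp ((h.amp r).comp (IsTP.relabel _))

theorem IsTP.traceRight : IsTP (traceRight : Op (x × y) x) := by
  rw [traceRight_eq]
  exact IsTP.traceLeft.comp (IsTP.relabel _)

theorem IsTP.attach {ω : Matrix y y ℂ} (hω : ω.trace = 1) : IsTP (attach ω : Op x (x × y)) := by
  intro X
  exact (Matrix.trace_kronecker X ω).trans (by rw [hω, mul_one])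

theorem IsTP.prepend {ω : Matrix y y ℂ} (hω : ω.trace = 1) : IsTP (prepend ω : Op x (y × x)) := by
  intro X
  exact (Matrix.trace_kronecker ω X).trans (by rw [hω, one_mul])

theorem IsTP.replaceBy {ω : Matrix y y ℂ} (hω : ω.trace = 1) : IsTP (replaceBy ω : Op x y) := by
  intro X
  simp [DQC.replaceBy, Matrix.trace_smul, hω]

/-- The image of a state under a completely positive and trace-preserving map. -/
def State.map (ψ : State x) (Φ : Op x y) (h : IsCP Φ) (h' : IsTP Φ) : State y :=
  ⟨Φ ψ.op, h.pos ψ.posSemidef, (h' _).trans ψ.trace_eq_one⟩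

theorem traceNorm_channel_le [DecidableEq x] [DecidableEq y] {Φ : Op x y} (h : IsCP Φ)
    (h' : IsTP Φ) {A : Matrix x x ℂ} (hA : A.IsHermitian) : traceNorm (Φ A) ≤ traceNorm A :=
  traceNorm_map_le Φ (fun _ => h.pos) (fun X _ => by rw [h' X]) hA

theorem traceDist_channel_le [DecidableEq x] [DecidableEq y] {Φ : Op x y} (h : IsCP Φ)
    (h' : IsTP Φ) {A B : Matrix x x ℂ} (hA : A.IsHermitian) (hB : B.IsHermitian) :
    traceDist (Φ A) (Φ B) ≤ traceDist A B := by
  unfold traceDist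
  rw [← map_sub]
  gcongr
  exact traceNorm_channel_le h h' (hA.sub hB)

theorem trace_conj_eq (K : Matrix y x ℂ) (X : Matrix x x ℂ) :
    (conj K X).trace = (K.conjTranspose * K * X).trace := by
  change (K * X * K.conjTranspose).trace = _
  rw [Matrix.trace_mul_comm, Matrix.mul_assoc]

/-- Conjugation with a coisometry does not increase the trace. -/
theorem trace_conj_coisometry_le [DecidableEq x] [DecidableEq y] {K : Matrix y x ℂ}
    (hK : K * K.conjTranspose = 1) {X : Matrix x x ℂ} (hX : X.PosSemidef) :
    (conj K X).trace.re ≤ X.trace.re := by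
  -- `K† K` is a projection, so its complement equals its own square and is positive.
  have h : (1 - K.conjTranspose * K).PosSemidef := by
    have h' := Matrix.posSemidef_conjTranspose_mul_self (1 - K.conjTranspose * K)
    have h2 : K.conjTranspose * K * (K.conjTranspose * K) = K.conjTranspose * K := by
      rw [Matrix.mul_assoc, ← Matrix.mul_assoc K, hK, Matrix.one_mul]
    simpa [Matrix.conjTranspose_sub, sub_mul, mul_sub, h2] using h'
  have h3 := trace_mul_re_nonneg h hX
  rw [trace_conj_eq]
  simpa [sub_mul] using h3

theorem projection_compl_posSemidef [DecidableEq x] {P : Matrix x x ℂ} (hP : IsStarProjection P) :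
    (1 - P).PosSemidef := by
  have h := Matrix.posSemidef_conjTranspose_mul_self (1 - P)
  have h1 : P.conjTranspose = P := hP.isSelfAdjoint
  have h2 : P * P = P := hP.isIdempotentElem
  simpa [Matrix.conjTranspose_sub, sub_mul, mul_sub, h1, h2] using h

theorem trace_conj_projections [DecidableEq x] {P : Matrix x x ℂ} (hP : IsStarProjection P)
    (X : Matrix x x ℂ) : (conj P X).trace + (conj (1 - P) X).trace = X.trace := by
  have h1 : P.conjTranspose = P := hP.isSelfAdjoint
  have h2 : P * P = P := hP.isIdempotentElem
  rw [trace_conj_eq, trace_conj_eq, ← Matrix.trace_add, ← add_mul]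
  simp [Matrix.conjTranspose_sub, sub_mul, mul_sub, h1, h2]

end trace

end

/-! ### Gentle measurements -/

section

variable {x y : Type} [Fintype x] [Fintype y] [DecidableEq x] [DecidableEq y]

/-- Cyclicity survives the partial trace for factors acting only on the traced system. It removes
the off-diagonal terms in `gentle_measurement`. -/
theorem traceLeft_mul_comm (A : Matrix x x ℂ) (Z : Matrix (x × y) (x × y) ℂ) :
    traceLeft ((A ⊗ₖ (1 : Matrix y y ℂ)) * Z) = traceLeft (Z * (A ⊗ₖ (1 : Matrix y y ℂ))) := by
  ext i j
  simp only [traceLeft, LinearMap.coe_mk, AddHom.coe_mk, Matrix.of_apply, Matrix.mul_apply,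
    Fintype.sum_prod_type, Matrix.kroneckerMap_apply, Matrix.one_apply, mul_ite, mul_one, mul_zero,
    ite_mul, zero_mul, Finset.sum_ite_eq, Finset.sum_ite_eq', Finset.mem_univ, if_true]
  rw [Finset.sum_comm]
  simp only [mul_comm]

/-- A rank-one projection leaves its system in the pure state `u`, hence uncorrelated with the rest:
each entry factors as `u i * star (u j)` times a compression of `Y` that does not involve `i` and
`j`. -/
theorem conj_pure_eq {u : x → ℂ} (hu : star u ⬝ᵥ u = 1) (Y : Matrix (x × y) (x × y) ℂ) :
    conj (Matrix.vecMulVec u (star u) ⊗ₖ (1 : Matrix y y ℂ)) Y =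
      Matrix.vecMulVec u (star u) ⊗ₖ
        traceLeft (conj (Matrix.vecMulVec u (star u) ⊗ₖ (1 : Matrix y y ℂ)) Y) := by
  have key : ∀ i j k l, conj (Matrix.vecMulVec u (star u) ⊗ₖ (1 : Matrix y y ℂ)) Y (i, k) (j, l) =
      u i * star (u j) * ∑ j', ∑ i', star (u i') * Y (i', k) (j', l) * u j' := by
    intro i j k l
    simp only [← amp_conj]
    change ((Matrix.vecMulVec u (star u)) * (Y.submatrix (fun i => (i, k)) fun j => (j, l)) *
      (Matrix.vecMulVec u (star u)).conjTranspose) i j = _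
    simp only [Matrix.mul_apply, Matrix.vecMulVec_apply, Matrix.conjTranspose_apply,
      Matrix.submatrix_apply, Pi.star_apply, star_mul', star_star, Finset.mul_sum, Finset.sum_mul]
    exact Finset.sum_congr rfl fun _ _ => Finset.sum_congr rfl fun _ _ => by ring
  ext ⟨i, k⟩ ⟨j, l⟩
  rw [key, Matrix.kroneckerMap_apply]
  simp only [traceLeft, LinearMap.coe_mk, AddHom.coe_mk, Matrix.of_apply, key, ← Finset.sum_mul]
  have h : ∑ i, u i * star (u i) = 1 := by
    rw [← hu]
    simp [dotProduct, mul_comm]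
  rw [h, one_mul, Matrix.vecMulVec_apply, Pi.star_apply]

theorem le_four_sqrt {t η : ℝ} (hη : 0 ≤ η) (hη1 : η ≤ 1)
    (h : ∀ w : ℝ, 0 < w → t ≤ w * η + w⁻¹ + 2 * η) : t ≤ 4 * √η := by
  rcases hη.eq_or_lt with rfl | hpos
  · simp only [mul_zero, zero_add, add_zero, Real.sqrt_zero] at h ⊢
    by_contra! ht
    -- For `η = 0` the infimum lies at `w → ∞`; the value `2 / t` would already give `t ≤ t / 2`.
    have := h (2 / t) (by positivity)
    rw [inv_div] at this
    linarith
  · have hs := Real.sqrt_pos.2 hpos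
    -- The minimizing weight is `η ^ (-1/2)`. It gives `2 √η + 2 η`, and `η ≤ √η` because `η ≤ 1`.
    have h1 := h (√η)⁻¹ (inv_pos.2 hs)
    have h2 : (√η)⁻¹ * η = √η := by
      nth_rewrite 2 [← Real.mul_self_sqrt hη]
      rw [← mul_assoc, inv_mul_cancel₀ hs.ne', one_mul]
    have h3 : η ≤ √η := Real.le_sqrt_of_sq_le (by nlinarith)
    rw [h2, inv_inv] at h1
    linarith

theorem kronecker_one_projection {P : Matrix x x ℂ} (hP : IsStarProjection P) :
    IsStarProjection (P ⊗ₖ (1 : Matrix y y ℂ)) := by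
  have h1 : P.conjTranspose = P := hP.isSelfAdjoint
  have h2 : P * P = P := hP.isIdempotentElem
  refine ⟨?_, ?_⟩
  · change (P ⊗ₖ (1 : Matrix y y ℂ)) * (P ⊗ₖ (1 : Matrix y y ℂ)) = _
    rw [← Matrix.mul_kronecker_mul, h2, Matrix.one_mul]
  · change (P ⊗ₖ (1 : Matrix y y ℂ)).conjTranspose = _
    rw [Matrix.conjTranspose_kronecker, h1, Matrix.conjTranspose_one]

theorem pure_projection {u : x → ℂ} (hu : star u ⬝ᵥ u = 1) :
    IsStarProjection (Matrix.vecMulVec u (star u)) := by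
  refine ⟨?_, ?_⟩
  · change Matrix.vecMulVec u (star u) * Matrix.vecMulVec u (star u) = _
    rw [Matrix.vecMulVec_mul_vecMulVec, hu, one_smul]
  · change (Matrix.vecMulVec u (star u)).conjTranspose = _
    rw [Matrix.conjTranspose_vecMulVec, star_star]

theorem trace_conj_projection {P : Matrix x x ℂ} (hP : IsStarProjection P) (X : Matrix x x ℂ) :
    (conj P X).trace = (P * X).trace := by
  have h1 : P.conjTranspose = P := hP.isSelfAdjoint
  have h2 : P * P = P := hP.isIdempotentElem
  rw [trace_conj_eq, h1, h2]

theorem trace_projection_mul_le {P : Matrix x x ℂ} (hP : IsStarProjection P)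
    {X : Matrix x x ℂ} (hX : X.PosSemidef) : (P * X).trace.re ≤ X.trace.re := by
  have h := trace_mul_re_nonneg (projection_compl_posSemidef hP) hX
  simpa [sub_mul] using h

/-- If a state on the range of `T + Q`, with `T` of rank one, is rarely found in `Q`, then it is
close to a product with `T`. -/
theorem gentle_measurement {u : x → ℂ} (hu : star u ⬝ᵥ u = 1) {Q : Matrix x x ℂ}
    (hQ : IsStarProjection Q) (huQ : Matrix.vecMulVec u (star u) * Q = 0)
    {Y : Matrix (x × y) (x × y) ℂ} (hY : Y.PosSemidef) (hY1 : Y.trace = 1) :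
    traceNorm (conj ((Matrix.vecMulVec u (star u) + Q) ⊗ₖ (1 : Matrix y y ℂ)) Y -
      Matrix.vecMulVec u (star u) ⊗ₖ
        traceLeft (conj ((Matrix.vecMulVec u (star u) + Q) ⊗ₖ (1 : Matrix y y ℂ)) Y)) ≤
      4 * √((Q ⊗ₖ (1 : Matrix y y ℂ)) * Y).trace.re := by
  have hTu := pure_projection hu
  have hTpure := conj_pure_eq hu Y
  have hT1 : (Matrix.vecMulVec u (star u)).trace = 1 := by
    rw [Matrix.trace_vecMulVec, dotProduct_comm, hu]
  have hTpos : (Matrix.vecMulVec u (star u)).PosSemidef := Matrix.posSemidef_vecMulVec_self_star u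
  -- That `T` has rank one enters from here on only through `hTpure` and `hT1`.
  generalize Matrix.vecMulVec u (star u) = T at *
  have hQT : Q * T = 0 := by
    have h := congrArg Matrix.conjTranspose huQ
    rwa [Matrix.conjTranspose_mul, show Q.conjTranspose = Q from hQ.isSelfAdjoint,
      show T.conjTranspose = T from hTu.isSelfAdjoint, Matrix.conjTranspose_zero] at h
  have hTt := kronecker_one_projection (y := y) hTu
  have hQt := kronecker_one_projection (y := y) hQ
  set η := ((Q ⊗ₖ (1 : Matrix y y ℂ)) * Y).trace.re with hη
  have hQY : (conj (Q ⊗ₖ (1 : Matrix y y ℂ)) Y).trace.re = η := by rw [trace_conj_projection hQt]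
  have hQYpos := conj_pos (Q ⊗ₖ (1 : Matrix y y ℂ)) hY
  have hTY : (conj (T ⊗ₖ (1 : Matrix y y ℂ)) Y).trace.re ≤ 1 := by
    rw [trace_conj_projection hTt]
    exact (trace_projection_mul_le hTt hY).trans_eq (by rw [hY1, Complex.one_re])
  have hη0 : 0 ≤ η := hQY ▸ trace_re_nonneg hQYpos
  have hη1 : η ≤ 1 := (trace_projection_mul_le hQt hY).trans_eq (by rw [hY1, Complex.one_re])
  refine le_four_sqrt hη0 hη1 fun w hw => ?_
  set T' := T ⊗ₖ (1 : Matrix y y ℂ) with hT'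
  set Q' := Q ⊗ₖ (1 : Matrix y y ℂ) with hQ'
  have hTh : T'.conjTranspose = T' := hTt.isSelfAdjoint
  have hQh : Q'.conjTranspose = Q' := hQt.isSelfAdjoint
  have hTQ' : T' * Q' = 0 := by
    rw [hT', hQ', ← Matrix.mul_kronecker_mul, huQ, Matrix.zero_kronecker]
  have hQT' : Q' * T' = 0 := by
    rw [hT', hQ', ← Matrix.mul_kronecker_mul, hQT, Matrix.zero_kronecker]
  -- The coherences between `T` and `Q` do not contribute to the marginal.
  have hcross1 : traceLeft (T' * Y * Q') = 0 := by
    rw [Matrix.mul_assoc, hT', traceLeft_mul_comm, ← hT', Matrix.mul_assoc, hQT', Matrix.mul_zero,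
      map_zero]
  have hcross2 : traceLeft (Q' * Y * T') = 0 := by
    rw [Matrix.mul_assoc, hQ', traceLeft_mul_comm, ← hQ', Matrix.mul_assoc, hTQ', Matrix.mul_zero,
      map_zero]
  -- The coherences are half the difference of the positive matrices `hplus` and `hminus`. The free
  -- weight `w` balances the small block `Q` against the large block `T`.
  let s : ℂ := (√w : ℝ)
  have hs : star s = s := Complex.conj_ofReal _
  have hs0 : s ≠ 0 := Complex.ofReal_ne_zero.2 (Real.sqrt_pos.2 hw).ne'
  have hss : s * s = (w : ℂ) := by
    rw [← Complex.ofReal_mul, Real.mul_self_sqrt hw.le]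
  have hconj : ∀ K : Matrix (x × y) (x × y) ℂ, conj K Y = K * Y * K.conjTranspose := fun _ => rfl
  have hplus : conj (s • Q' + s⁻¹ • T') Y = (w : ℂ) • conj Q' Y + (w⁻¹ : ℂ) • conj T' Y +
      (T' * Y * Q' + Q' * Y * T') := by
    simp only [hconj, Matrix.conjTranspose_add, Matrix.conjTranspose_smul, hTh, hQh, star_inv₀, hs,
      add_mul, mul_add, Matrix.smul_mul, Matrix.mul_smul, smul_smul, ← hss, mul_inv,
      mul_inv_cancel₀ hs0, inv_mul_cancel₀ hs0, one_smul]
    abel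
  have hminus : conj (s • Q' - s⁻¹ • T') Y = (w : ℂ) • conj Q' Y + (w⁻¹ : ℂ) • conj T' Y -
      (T' * Y * Q' + Q' * Y * T') := by
    simp only [hconj, Matrix.conjTranspose_sub, Matrix.conjTranspose_smul, hTh, hQh, star_inv₀, hs,
      sub_mul, mul_sub, Matrix.smul_mul, Matrix.mul_smul, smul_smul, ← hss, mul_inv,
      mul_inv_cancel₀ hs0, inv_mul_cancel₀ hs0, one_smul]
    abel
  have hS : conj ((T + Q) ⊗ₖ (1 : Matrix y y ℂ)) Y =
      conj T' Y + conj Q' Y + (T' * Y * Q' + Q' * Y * T') := by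
    rw [Matrix.add_kronecker, ← hT', ← hQ']
    simp only [hconj, Matrix.conjTranspose_add, hTh, hQh, add_mul, mul_add]
    abel
  -- The `T` block cancels by `hTpure`. What remains is a difference of two positive matrices whose
  -- traces sum to at most `w η + w⁻¹ + 2 η`.
  have hdiff : conj ((T + Q) ⊗ₖ (1 : Matrix y y ℂ)) Y -
      T ⊗ₖ traceLeft (conj ((T + Q) ⊗ₖ (1 : Matrix y y ℂ)) Y) =
      ((1 / 2 : ℂ) • conj (s • Q' + s⁻¹ • T') Y + conj Q' Y) -
        ((1 / 2 : ℂ) • conj (s • Q' - s⁻¹ • T') Y + T ⊗ₖ traceLeft (conj Q' Y)) := by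
    rw [hS, map_add, map_add, map_add, hcross1, hcross2, add_zero, add_zero, Matrix.kronecker_add,
      ← hTpure, hplus, hminus]
    module
  have half : (0 : ℂ) ≤ 1 / 2 := by
    rw [Complex.le_def]
    norm_num
  have hpos1 := (conj_pos (s • Q' + s⁻¹ • T') hY).smul half
  have hpos2 := (conj_pos (s • Q' - s⁻¹ • T') hY).smul half
  rw [hdiff]
  refine (traceNorm_sub_le (hpos1.add hQYpos)
    (hpos2.add (posSemidef_kronecker hTpos (posSemidef_traceLeft hQYpos)))).trans ?_
  rw [hplus, hminus]
  have hwinv : (w : ℂ)⁻¹ = ((w⁻¹ : ℝ) : ℂ) := by push_cast; rfl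
  have e1 : ((1 / 2 : ℂ)) = ((1 / 2 : ℝ) : ℂ) := by norm_num
  simp only [Matrix.trace_add, Matrix.trace_sub, Matrix.trace_smul, Matrix.trace_kronecker,
    trace_traceLeft, hT1, one_mul, smul_eq_mul, hwinv, e1, Complex.add_re, Complex.re_ofReal_mul,
    Complex.sub_re, hQY]
  have : w⁻¹ * (conj T' Y).trace.re ≤ w⁻¹ * 1 := by gcongr
  linarith

end

/-! ### Runs of a protocol as completely positive and trace-preserving maps -/

section

variable {x y r : Type} [Fintype x] [Fintype y]

theorem ampLeft_kronecker (Φ : Op x y) (X : Matrix x x ℂ) (Y : Matrix r r ℂ) :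
    ampLeft r Φ (Y ⊗ₖ X) = Y ⊗ₖ Φ X := by
  have h : relabel (Equiv.prodComm r x) (Y ⊗ₖ X) = X ⊗ₖ Y := by
    ext i j
    exact mul_comm _ _
  change relabel (Equiv.prodComm y r) (amp Φ r (relabel (Equiv.prodComm r x) (Y ⊗ₖ X))) = _
  rw [h, amp_kronecker]
  ext i j
  exact mul_comm _ _

theorem traceLeft_ampLeft [Fintype r] (Φ : Op x y) (X : Matrix (r × x) (r × x) ℂ) :
    traceLeft (ampLeft r Φ X) = Φ (traceLeft X) := by
  have h : traceLeft X = ∑ k, X.submatrix (fun i => (k, i)) (fun i => (k, i)) := by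
    ext i j
    simp [traceLeft, Matrix.sum_apply]
  rw [h, map_sum]
  ext i j
  rw [Matrix.sum_apply]
  rfl

theorem ampLeft_conj [Fintype r] [DecidableEq r] (K : Matrix y x ℂ) :
    ampLeft r (conj K) = conj ((1 : Matrix r r ℂ) ⊗ₖ K) := by
  ext X i j
  change (K * (X.submatrix (fun k => (i.1, k)) fun k => (j.1, k)) * K.conjTranspose) i.2 j.2 = _
  simp [conj, Matrix.mul_apply, Fintype.sum_prod_type, Matrix.one_apply, apply_ite]

theorem traceLeft_kronecker [Fintype r] (X : Matrix r r ℂ) (Y : Matrix y y ℂ) :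
    traceLeft (X ⊗ₖ Y) = X.trace • Y := by
  ext i j
  simp [traceLeft, Matrix.trace, Finset.sum_mul]

theorem single_posSemidef [DecidableEq x] (i : x) :
    (Matrix.single i i (1 : ℂ)).PosSemidef := by
  rw [← Matrix.diagonal_single]
  refine Matrix.PosSemidef.diagonal fun j => ?_
  by_cases h : j = i <;> simp [h]

theorem single_trace [DecidableEq x] (i : x) : (Matrix.single i i (1 : ℂ)).trace = 1 :=
  Matrix.trace_single_eq_same i 1

/-- A basis state. -/
def basisState [DecidableEq x] (i : x) : State x :=
  ⟨Matrix.single i i 1, single_posSemidef i, single_trace i⟩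

end

/-- The verdict of the measurement of the verification register, `true` for an error. -/
def verdict {v : Type} [Fintype v] [DecidableEq v] (P : Matrix v v ℂ) : Op v Bool :=
  replaceBy (Matrix.single false false 1) ∘ₗ conj P +
    replaceBy (Matrix.single true true 1) ∘ₗ conj (1 - P)

/-- Alice's output as determined by her measurement. -/
def output (a : Type) {v : Type} [Fintype a] [Fintype v] [DecidableEq a] [DecidableEq v]
    (P : Matrix v v ℂ) : Op (a × v) (Option a) :=
  embed ∘ₗ traceRight ∘ₗ branch P + errFlag (a × v) a ∘ₗ branch (1 - P)

section

variable {n : ℕ} {a c m v b : Type} [Fintype a] [Fintype c] [Fintype m] [Fintype v] [Fintype b]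
  [DecidableEq a] [DecidableEq c] [DecidableEq v]

theorem foldl_induction {α : Type} (p : α → Prop) {n : ℕ} (f : α → Fin n → α)
    (h : ∀ y i, p y → p (f y i)) {x : α} (hx : p x) : p (Fin.foldl n f x) := by
  induction n generalizing x with
  | zero => simpa using hx
  | succ n ih =>
    rw [Fin.foldl_succ]
    exact ih _ (fun y i => h y i.succ) (h x 0 hx)

theorem interact_isCP (S : Fin n → Channel (m × c) (m × c)) (F : Fin n → Channel (c × b) (c × b)) :
    IsCP (interact S F) := by
  refine foldl_induction IsCP _ (fun Φ i h => ?_) IsCP.id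
  exact ((S i).isCP.amp b).comp ((IsCP.relabel _).comp (((F i).isCP.ampLeft m).comp
    ((IsCP.relabel _).comp h)))

theorem interact_isTP (S : Fin n → Channel (m × c) (m × c)) (F : Fin n → Channel (c × b) (c × b)) :
    IsTP (interact S F) := by
  refine foldl_induction IsTP _ (fun Φ i h => ?_) IsTP.id
  exact ((S i).isTP.amp b).comp ((IsTP.relabel _).comp (((F i).isTP.ampLeft m).comp
    ((IsTP.relabel _).comp h)))

theorem branch_isCP (P : Matrix v v ℂ) : IsCP (branch P : Op (a × v) (a × v)) :=
  IsCP.conj _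

theorem branch_trace {P : Matrix v v ℂ} (hP : IsStarProjection P)
    (X : Matrix (a × v) (a × v) ℂ) :
    (branch P X).trace + (branch (1 - P) X).trace = X.trace := by
  unfold branch
  rw [← ampLeft_conj, ← ampLeft_conj, ← trace_traceLeft, ← trace_traceLeft (ampLeft _ _ _),
    traceLeft_ampLeft, traceLeft_ampLeft, trace_conj_projections hP, trace_traceLeft]

theorem measurement_isTP {P : Matrix v v ℂ} (hP : IsStarProjection P) :
    IsTP (branch P + branch (1 - P) : Op (a × v) (a × v)) := by
  intro X
  rw [LinearMap.add_apply, Matrix.trace_add, branch_trace hP]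

theorem verdict_isCP (P : Matrix v v ℂ) : IsCP (verdict P) :=
  ((IsCP.replaceBy (single_posSemidef _)).comp (IsCP.conj _)).add
    ((IsCP.replaceBy (single_posSemidef _)).comp (IsCP.conj _))

theorem verdict_isTP {P : Matrix v v ℂ} (hP : IsStarProjection P) : IsTP (verdict P) := by
  intro X
  change (replaceBy _ (conj P X) + replaceBy _ (conj (1 - P) X)).trace = _
  rw [Matrix.trace_add, IsTP.replaceBy (single_trace _), IsTP.replaceBy (single_trace _),
    trace_conj_projections hP]

theorem embed_isometry : (Matrix.of fun (i : Option a) (j : a) => if i = some j then (1 : ℂ)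
    else 0).conjTranspose * (Matrix.of fun (i : Option a) (j : a) => if i = some j then (1 : ℂ)
    else 0) = 1 := by
  ext i j
  rcases eq_or_ne i j with rfl | h
  · simp [Matrix.mul_apply, apply_ite]
  · simp [Matrix.mul_apply, apply_ite, h, h.symm]

theorem embed_isTP : IsTP (embed : Op a (Option a)) := by
  intro X
  unfold embed
  rw [trace_conj_eq, embed_isometry, Matrix.one_mul]

theorem output_isCP (P : Matrix v v ℂ) : IsCP (output a P) :=
  ((IsCP.conj _).comp (IsCP.traceRight.comp (branch_isCP P))).add
    ((IsCP.replaceBy (single_posSemidef _)).comp (branch_isCP _))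

theorem output_isTP {P : Matrix v v ℂ} (hP : IsStarProjection P) : IsTP (output a P) := by
  intro X
  change (embed (traceRight (branch P X)) + replaceBy _ (branch (1 - P) X)).trace = _
  rw [Matrix.trace_add, embed_isTP, IsTP.traceRight, IsTP.replaceBy (single_trace _),
    branch_trace hP]

namespace Protocol

variable (π : Protocol n a c m v) (F : Fin n → Channel (c × b) (c × b))

theorem measured_isCP : IsCP (π.measured F) :=
  (((branch_isCP _).add (branch_isCP _)).amp b).comp ((π.last.isCP.amp b).comp
    ((interact_isCP _ _).comp ((π.first.isCP.amp b).comp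
      ((IsCP.attach (single_posSemidef _)).amp b))))

theorem measured_isTP : IsTP (π.measured F) :=
  ((measurement_isTP π.isProjection).amp b).comp ((π.last.isTP.amp b).comp
    ((interact_isTP _ _).comp ((π.first.isTP.amp b).comp
      ((IsTP.attach (single_trace _)).amp b))))

theorem run_isCP : IsCP (π.run F) := ((output_isCP _).amp b).comp (π.measured_isCP F)

theorem run_isTP : IsTP (π.run F) := ((output_isTP π.isProjection).amp b).comp (π.measured_isTP F)

/-- The joint state of Alice's verdict and the server's register at the end of a run. -/
def statistic : Op (a × b) (Bool × b) :=
  amp (verdict π.accept) b ∘ₗ traceLeft ∘ₗ relabel (Equiv.prodAssoc a v b) ∘ₗ π.measured F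

theorem statistic_isCP : IsCP (π.statistic F) :=
  ((verdict_isCP _).amp b).comp (IsCP.traceLeft.comp ((IsCP.relabel _).comp (π.measured_isCP F)))

/-- Forming the output is trace-preserving on Alice's side, which is then discarded. So blindness,
stated for `run`, can be chained with independence, stated for `measured`. -/
theorem traceLeft_run : traceLeft ∘ₗ π.run F = traceLeft ∘ₗ π.measured F := by
  ext1 X
  exact traceLeft_amp (output_isTP π.isProjection) (π.measured F X)

end Protocol

/-- The verdict and the server's register do not depend on Alice's input. -/
theorem statistic_close (π : Protocol n a c m v) {U : Matrix.unitaryGroup a ℂ} {εbl εind εver : ℝ}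
    (hbl : StandAloneBlind π εbl) (hver : StandAloneIndependentVerifiable π U εind εver)
    [DecidableEq b] (F : Fin n → Channel (c × b) (c × b)) {r : Type} [Fintype r] [DecidableEq r]
    (ψ ψ' : State ((a × b) × r)) (h : amp traceLeft r ψ.op = amp traceLeft r ψ'.op) :
    traceDist (amp (π.statistic F) r ψ.op) (amp (π.statistic F) r ψ'.op) ≤
      2 * (εbl + εind) := by
  obtain ⟨β, F', hF'⟩ := hver.2 b F
  obtain ⟨G, hG⟩ := hbl (v × b) F'
  set W : Op (a × b) (v × b) := traceLeft ∘ₗ relabel (Equiv.prodAssoc a v b) ∘ₗ π.measured F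
    with hW
  have hWcp : IsCP W := IsCP.traceLeft.comp ((IsCP.relabel _).comp (π.measured_isCP F))
  have hpcp : IsCP (ampLeft a (prepend β.op : Op b (v × b))) :=
    (IsCP.prepend β.posSemidef).ampLeft a
  have hptp : IsTP (ampLeft a (prepend β.op : Op b (v × b))) :=
    (IsTP.prepend β.trace_eq_one).ampLeft a
  -- `L` discards `A` before anything else happens, so it cannot distinguish `ψ` from `ψ'`.
  set L : Op (a × b) (v × b) := G.map ∘ₗ traceLeft ∘ₗ ampLeft a (prepend β.op) with hL
  have hLcp : IsCP L := G.isCP.comp (IsCP.traceLeft.comp hpcp)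
  have hLeq : L = (G.map ∘ₗ prepend β.op) ∘ₗ traceLeft := by
    rw [hL]
    ext1 X
    exact congrArg G.map (traceLeft_ampLeft (prepend β.op) X)
  -- Independence replaces Alice's verification register by the server's copy; blindness against the
  -- server `F'`, whose register includes that copy, then removes the input. Using this for both
  -- states gives the factor `2`.
  have key : ∀ χ : State ((a × b) × r), traceDist (amp W r χ.op) (amp L r χ.op) ≤ εind + εbl := by
    intro χ
    have h1 := hF' r χ
    have h2 := hG r (χ.map _ (hpcp.amp r) (hptp.amp r))
    rw [π.traceLeft_run] at h2
    refine (traceDist_triangle ?_ ?_ ?_).trans (add_le_add h1 h2)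
    · exact ((hWcp.amp r).pos χ.posSemidef).isHermitian
    · exact (((IsCP.traceLeft.comp ((π.measured_isCP F').comp hpcp)).amp r).pos
        χ.posSemidef).isHermitian
    · exact ((hLcp.amp r).pos χ.posSemidef).isHermitian
  have hLL : amp L r ψ.op = amp L r ψ'.op := by
    rw [hLeq, amp_comp, LinearMap.comp_apply, LinearMap.comp_apply, h]
  have hWh : ∀ χ : State ((a × b) × r), (amp W r χ.op).IsHermitian :=
    fun χ => ((hWcp.amp r).pos χ.posSemidef).isHermitian
  have hLh : ∀ χ : State ((a × b) × r), (amp L r χ.op).IsHermitian :=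
    fun χ => ((hLcp.amp r).pos χ.posSemidef).isHermitian
  have hv := traceDist_channel_le (((verdict_isCP π.accept).amp b).amp r)
    (((verdict_isTP π.isProjection).amp b).amp r) (hWh ψ) (hWh ψ')
  have h3 := traceDist_triangle (hWh ψ) (hLh ψ) (hWh ψ')
  have h4 := key ψ'
  rw [traceDist_comm (hWh ψ') (hLh ψ'), ← hLL] at h4
  have h5 := key ψ
  refine hv.trans ?_
  linarith

end

/-! ### The simulator -/

/-- The block of a matrix in which the left register is in a basis state. -/
def block {x y : Type} (i : x) : Op (x × y) y where
  toFun X := X.submatrix (fun k => (i, k)) (fun k => (i, k))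
  map_add' _ _ := rfl
  map_smul' _ _ := rfl

theorem IsCP.block {x y : Type} (i : x) : IsCP (block i : Op (x × y) y) :=
  fun _ _ _ hX => hX.submatrix _

section

variable {n : ℕ} {a c m v ℓ r : Type} [Fintype a] [Fintype c] [Fintype m] [Fintype v]
  [Fintype ℓ] [Fintype r] [DecidableEq a] [DecidableEq c] [DecidableEq v] [DecidableEq m]
  [DecidableEq ℓ]

namespace Protocol

/-- The state of Alice's registers after her first message, for the input `φ`. -/
def firstState (π : Protocol n a c m v) (φ : State a) : State (m × c) :=
  (φ.map (attach (Matrix.single π.start π.start 1)) (IsCP.attach (single_posSemidef _))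
    (IsTP.attach (single_trace _))).map _ π.first.isCP π.first.isTP

/-- The first measurement is redundant before the verdict, but with it the composite agrees
definitionally with the end of `statistic`. -/
theorem last_verdict_isCP (π : Protocol n a c m v) :
    IsCP (verdict π.accept ∘ₗ traceLeft ∘ₗ (branch π.accept + branch (1 - π.accept)) ∘ₗ
      π.last.map) :=
  (verdict_isCP _).comp (IsCP.traceLeft.comp (((branch_isCP _).add (branch_isCP _)).comp
    π.last.isCP))

theorem last_verdict_isTP (π : Protocol n a c m v) :
    IsTP (verdict π.accept ∘ₗ traceLeft ∘ₗ (branch π.accept + branch (1 - π.accept)) ∘ₗ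
      π.last.map) :=
  (verdict_isTP π.isProjection).comp (IsTP.traceLeft.comp ((measurement_isTP π.isProjection).comp
    π.last.isTP))

/-- The simulator that runs Alice's protocol on the dummy input `φ` and lets the ideal resource
output the error flag if this run is rejected. -/
def simulator (π : Protocol n a c m v) (φ : State a) (m₀ : m) (ℓ : Type) [Fintype ℓ] :
    Simulator n c ℓ m where
  prep := ⟨Matrix.single true true 1 ⊗ₖ Matrix.single m₀ m₀ 1,
    posSemidef_kronecker (single_posSemidef _) (single_posSemidef _), by
      rw [Matrix.trace_kronecker, single_trace, single_trace, one_mul]⟩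
  start := toChannel (replaceBy (π.firstState φ).op)
    (IsCP.replaceBy (π.firstState φ).posSemidef) (IsTP.replaceBy (π.firstState φ).trace_eq_one)
  step := π.step
  finish := toChannel _ π.last_verdict_isCP π.last_verdict_isTP

theorem simulator_opening (π : Protocol n a c m v) (φ : State a) (m₀ : m) (leak : ℓ) :
    (π.simulator φ m₀ ℓ).opening leak =
      Matrix.single true true (1 : ℂ) ⊗ₖ (π.firstState φ).op := by
  have h1 : leakStage leak (Matrix.single true true (1 : ℂ)) =
      Matrix.single true true (1 : ℂ) ⊗ₖ Matrix.single (some leak) (some leak) (1 : ℂ) := by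
    rw [Matrix.single_kronecker_single, mul_one]
    simp [leakStage, conj, Matrix.conjTranspose_single]
  change ampLeft Bool (replaceBy (π.firstState φ).op) (relabel (Equiv.prodAssoc Bool (Option ℓ) m)
    (amp (leakStage leak) m (Matrix.single true true 1 ⊗ₖ Matrix.single m₀ m₀ 1))) = _
  rw [amp_kronecker, h1]
  have h2 : relabel (Equiv.prodAssoc Bool (Option ℓ) m) ((Matrix.single true true (1 : ℂ) ⊗ₖ
      Matrix.single (some leak) (some leak) (1 : ℂ)) ⊗ₖ Matrix.single m₀ m₀ 1) =
      Matrix.single true true (1 : ℂ) ⊗ₖ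
        (Matrix.single (some leak) (some leak) (1 : ℂ) ⊗ₖ Matrix.single m₀ m₀ 1) :=
    Matrix.kronecker_assoc _ _ _
  rw [h2, ampLeft_kronecker]
  simp [replaceBy, Matrix.trace_kronecker]

/-- For a product input, Alice's first message is independent of the server's register; this
identifies the simulator's rounds with a run on the dummy. -/
theorem statistic_kronecker (π : Protocol n a c m v) (D : Fin n → Channel (c × r) (c × r))
    (φ : State a) (X : Matrix r r ℂ) :
    π.statistic D (φ.op ⊗ₖ X) =
      amp (verdict π.accept ∘ₗ traceLeft ∘ₗ (branch π.accept + branch (1 - π.accept)) ∘ₗ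
        π.last.map) r (interact π.step D ((π.firstState φ).op ⊗ₖ X)) := by
  have h : amp π.first.map r (amp (attach (Matrix.single π.start π.start 1)) r (φ.op ⊗ₖ X)) =
      (π.firstState φ).op ⊗ₖ X := by
    rw [amp_kronecker, amp_kronecker]
    rfl
  rw [← h]
  rfl

/-- The unnormalized state of the server's register after a run with the dummy input `φ` and the
given verdict. -/
def simulated (π : Protocol n a c m v) (D : Fin n → Channel (c × r) (c × r)) (φ : State a)
    (error : Bool) : Op r r :=
  block error ∘ₗ π.statistic D ∘ₗ prepend φ.op

end Protocol

theorem conj_pick (bits : Bool × Bool) (X : Matrix (a × (Bool × Bool)) (a × (Bool × Bool)) ℂ) :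
    conj (Matrix.of fun (i : a) j => if j = (i, bits) then 1 else 0) X =
      X.submatrix (fun i => (i, bits)) (fun i => (i, bits)) := by
  ext i j
  simp [conj, Matrix.mul_apply, apply_ite]

theorem outputStage_apply (U : Matrix.unitaryGroup a ℂ)
    (X : Matrix (a × (Bool × Bool)) (a × (Bool × Bool)) ℂ)
    (hX : ∀ c, X.submatrix (fun i => (i, (false, c))) (fun i => (i, (false, c))) = 0) :
    outputStage U X =
      target U (X.submatrix (fun i => (i, (true, false))) (fun i => (i, (true, false)))) +
        errFlag a a (X.submatrix (fun i => (i, (true, true))) (fun i => (i, (true, true)))) := by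
  have h : outputStage U X = ∑ bits : Bool × Bool,
      (if bits.1 && bits.2 then errFlag a a else target U)
        (X.submatrix (fun i => (i, bits)) (fun i => (i, bits))) := by
    rw [outputStage, LinearMap.sum_apply]
    refine Finset.sum_congr rfl fun bits _ => ?_
    rw [LinearMap.comp_apply, conj_pick]
  rw [h, Fintype.sum_prod_type, Fintype.sum_bool, Fintype.sum_bool, Fintype.sum_bool, hX, hX,
    map_zero, map_zero, add_zero, add_zero, add_comm]
  rfl

/-- The simulator never touches `A`, so for each value of `c` the ideal run acts separately on `A`
(result or flag) and on `R` (the dummy run with that verdict). -/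
theorem idealRun_simulator (π : Protocol n a c m v) (φ : State a) (m₀ : m) (leak : ℓ)
    (U : Matrix.unitaryGroup a ℂ) (D : Fin n → Channel (c × r) (c × r)) :
    idealRun U leak (π.simulator φ m₀ ℓ) D =
      amp (target U) r ∘ₗ ampLeft a (π.simulated D φ false) +
        amp (errFlag a a) r ∘ₗ ampLeft a (π.simulated D φ true) := by
  ext1 ψ
  -- `Z` is the state before the output stage, kept opaque to control unfolding. Only its blocks
  -- diagonal in both control bits matter.
  obtain ⟨Z, hZ⟩ : ∃ Z, Z = amp (amp (π.simulator φ m₀ ℓ).finish.map r) (a × Bool)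
      (amp (interact (π.simulator φ m₀ ℓ).step D) (a × Bool)
        ((ψ ⊗ₖ (π.simulator φ m₀ ℓ).opening leak).submatrix
          (fun q : ((m × c) × r) × (a × Bool) => ((q.2.1, q.1.2), (q.2.2, q.1.1)))
          (fun q : ((m × c) × r) × (a × Bool) => ((q.2.1, q.1.2), (q.2.2, q.1.1))))) := ⟨_, rfl⟩
  have hrun : ∀ o o' k l, idealRun U leak (π.simulator φ m₀ ℓ) D ψ (o, k) (o', l) =
      outputStage U (Z.submatrix (fun p => ((p.2.2, k), (p.1, p.2.1)))
        (fun p => ((p.2.2, l), (p.1, p.2.1)))) o o' := by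
    intro o o' k l
    rw [hZ]
    rfl
  have key : ∀ i j : a, ∀ (bit e : Bool) (k l : r), Z ((e, k), (i, bit)) ((e, l), (j, bit)) =
      if bit then ampLeft a (π.simulated D φ e) ψ (i, k) (j, l) else 0 := by
    intro i j bit e k l
    -- For fixed indices of `A` the distinguisher sees only the operator `ψij`, and the block with
    -- `b = 0` vanishes by `simulator_opening`.
    set ψij : Matrix r r ℂ := ψ.submatrix (fun k => (i, k)) (fun k => (j, k))
    have hslice : ((ψ ⊗ₖ (π.simulator φ m₀ ℓ).opening leak).submatrix
            (fun q : (m × c) × r => ((i, q.2), (bit, q.1)))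
            (fun q : (m × c) × r => ((j, q.2), (bit, q.1)))) =
        (if bit then (1 : ℂ) else 0) • ((π.firstState φ).op ⊗ₖ ψij) := by
      rw [π.simulator_opening]
      ext p q
      cases bit <;> simp [ψij, mul_comm]
    rw [hZ]
    change amp (verdict π.accept ∘ₗ traceLeft ∘ₗ (branch π.accept + branch (1 - π.accept)) ∘ₗ
        π.last.map) r (interact π.step D ((ψ ⊗ₖ (π.simulator φ m₀ ℓ).opening leak).submatrix
            (fun q : (m × c) × r => ((i, q.2), (bit, q.1)))
            (fun q : (m × c) × r => ((j, q.2), (bit, q.1))))) (e, k) (e, l) = _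
    rw [hslice, map_smul, map_smul, ← π.statistic_kronecker]
    cases bit
    · simp
    · simp only [if_true, one_smul]
      rfl
  have hout : ∀ e k l, (Z.submatrix (fun p : a × (Bool × Bool) => ((p.2.2, k), (p.1, p.2.1)))
      (fun p => ((p.2.2, l), (p.1, p.2.1)))).submatrix (fun i => (i, (true, e)))
        (fun i => (i, (true, e))) = (ampLeft a (π.simulated D φ e) ψ).submatrix
          (fun i => (i, k)) (fun i => (i, l)) := by
    intro e k l
    ext i j
    exact (key i j true e k l).trans (if_pos rfl)
  ext ⟨o, k⟩ ⟨o', l⟩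
  rw [hrun, outputStage_apply, hout, hout]
  · rfl
  · intro e
    ext i j
    exact (key i j false e k l).trans (if_neg Bool.false_ne_true)

end

/-! ### Verified runs on pure inputs -/

section

variable {a v : Type} [Fintype a] [Fintype v] [DecidableEq a] [DecidableEq v]

theorem embed_some_some (X : Matrix a a ℂ) (i j : a) : embed X (some i) (some j) = X i j := by
  simp [embed, conj, Matrix.mul_apply, apply_ite]

theorem embed_none_left (X : Matrix a a ℂ) (o : Option a) : embed X none o = 0 := by
  simp [embed, conj, Matrix.mul_apply]

theorem embed_none_right (X : Matrix a a ℂ) (o : Option a) : embed X o none = 0 := by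
  simp [embed, conj, Matrix.mul_apply]

theorem trace_branch (P : Matrix v v ℂ) (X : Matrix (a × v) (a × v) ℂ) :
    (branch P X).trace = (conj P (traceLeft X)).trace := by
  unfold branch
  rw [← ampLeft_conj, ← trace_traceLeft, traceLeft_ampLeft]

theorem verdict_apply (P : Matrix v v ℂ) (X : Matrix v v ℂ) :
    verdict P X = (conj P X).trace • Matrix.single false false 1 +
      (conj (1 - P) X).trace • Matrix.single true true 1 := rfl

theorem output_apply (P : Matrix v v ℂ) (X : Matrix (a × v) (a × v) ℂ) :
    output a P X = embed (traceRight (branch P X)) +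
      (branch (1 - P) X).trace • Matrix.single none none 1 := rfl

/-- The weights of the flag and of the valid block in the output are those of the two verdicts.
Together with the vanishing coherences below, this links the output to the statistic. -/
theorem output_none_none (P : Matrix v v ℂ) (X : Matrix (a × v) (a × v) ℂ) :
    output a P X none none = verdict P (traceLeft X) true true := by
  rw [output_apply, verdict_apply, Matrix.add_apply, embed_none_left, trace_branch]
  simp

theorem sum_output_some (P : Matrix v v ℂ) (X : Matrix (a × v) (a × v) ℂ) :
    ∑ i, output a P X (some i) (some i) = verdict P (traceLeft X) false false := by
  have h : ∑ i, output a P X (some i) (some i) = (traceRight (branch P X)).trace := by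
    refine Finset.sum_congr rfl fun i _ => ?_
    rw [output_apply, Matrix.add_apply, embed_some_some]
    simp
  rw [h, IsTP.traceRight, trace_branch, verdict_apply]
  simp

theorem output_some_none (P : Matrix v v ℂ) (X : Matrix (a × v) (a × v) ℂ) (i : a) :
    output a P X (some i) none = 0 := by
  rw [output_apply, Matrix.add_apply, embed_none_right]
  simp

theorem output_none_some (P : Matrix v v ℂ) (X : Matrix (a × v) (a × v) ℂ) (i : a) :
    output a P X none (some i) = 0 := by
  rw [output_apply, Matrix.add_apply, embed_none_left]
  simp

end

/-- The projection of Alice's output and a reference system on the valid outputs. -/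
def valid (a r : Type) [DecidableEq a] [DecidableEq r] : Matrix (Option a × r) (Option a × r) ℂ :=
  Matrix.diagonal fun i => if i.1.isSome then 1 else 0

/-! ### Rebuilding the output from the verdict -/

section

variable {a b v r₁ r₂ : Type} [Fintype a] [Fintype b] [Fintype v] [Fintype r₁] [Fintype r₂]
  [DecidableEq a] [DecidableEq b] [DecidableEq v] [DecidableEq r₁] [DecidableEq r₂]

/-- If the verdict is positive, the first reference system is replaced by `T`, and otherwise the
error flag is prepared. -/
def assemble (T : Matrix (Option a × r₁) (Option a × r₁) ℂ) :
    Op ((Bool × b) × (r₁ × r₂)) ((Option a × r₁) × (b × r₂)) :=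
  let e : b × (r₁ × r₂) ≃ r₁ × (b × r₂) :=
    { toFun := fun i => (i.2.1, (i.1, i.2.2))
      invFun := fun i => (i.2.1, (i.1, i.2.2))
      left_inv := fun _ => rfl
      right_inv := fun _ => rfl }
  prepend T ∘ₗ traceLeft ∘ₗ relabel e ∘ₗ amp (block false) (r₁ × r₂) +
    relabel (Equiv.prodProdProdComm (Option a) b r₁ r₂) ∘ₗ
      amp (prepend (Matrix.single none none 1)) (r₁ × r₂) ∘ₗ amp (block true) (r₁ × r₂)

theorem assemble_pos {T : Matrix (Option a × r₁) (Option a × r₁) ℂ} (hT : T.PosSemidef)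
    {Y : Matrix ((Bool × b) × (r₁ × r₂)) ((Bool × b) × (r₁ × r₂)) ℂ} (hY : Y.PosSemidef) :
    (assemble T Y).PosSemidef :=
  (((IsCP.prepend hT).comp (IsCP.traceLeft.comp ((IsCP.relabel _).comp
    ((IsCP.block false).amp (r₁ × r₂))))).pos hY).add
    (((IsCP.relabel _).comp (((IsCP.prepend (single_posSemidef _)).amp (r₁ × r₂)).comp
      ((IsCP.block true).amp (r₁ × r₂)))).pos hY)

theorem assemble_trace {T : Matrix (Option a × r₁) (Option a × r₁) ℂ} (hT : T.trace = 1)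
    (Y : Matrix ((Bool × b) × (r₁ × r₂)) ((Bool × b) × (r₁ × r₂)) ℂ) :
    (assemble T Y).trace = Y.trace := by
  have h : Y.trace = (amp (block false) (r₁ × r₂) Y).trace +
      (amp (block true) (r₁ × r₂) Y).trace := by
    simp only [Matrix.trace, Fintype.sum_prod_type, Fintype.sum_bool]
    exact add_comm _ _
  simp only [assemble, LinearMap.add_apply, LinearMap.comp_apply]
  rw [h, Matrix.trace_add, IsTP.prepend hT, IsTP.traceLeft, IsTP.relabel, IsTP.relabel,
    (IsTP.prepend (single_trace _)).amp]

theorem conj_apply {x y : Type} [Fintype x] (K : Matrix y x ℂ) (X : Matrix x x ℂ) :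
    conj K X = K * X * K.conjTranspose := rfl

theorem conj_valid_apply (X : Matrix ((Option a × r₁) × (b × r₂)) ((Option a × r₁) × (b × r₂)) ℂ)
    (i j) : conj (valid a r₁ ⊗ₖ (1 : Matrix (b × r₂) (b × r₂) ℂ)) X i j =
      if i.1.1.isSome ∧ j.1.1.isSome then X i j else 0 := by
  have h : valid a r₁ ⊗ₖ (1 : Matrix (b × r₂) (b × r₂) ℂ) =
      Matrix.diagonal fun i => if i.1.1.isSome then (1 : ℂ) else 0 := by
    rw [valid, ← Matrix.diagonal_one, Matrix.diagonal_kronecker_diagonal]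
    simp
  rw [h, conj_apply, Matrix.diagonal_conjTranspose, Matrix.mul_diagonal, Matrix.diagonal_mul]
  by_cases h1 : i.1.1.isSome <;> by_cases h2 : j.1.1.isSome <;> simp [h1, h2]

/-- The output has no coherence between flag and valid part, and `assemble` reproduces its error
block exactly. The error parts cancel, leaving the expression bounded by `gentle_measurement`. -/
theorem assemble_verdict (P : Matrix v v ℂ) (T : Matrix (Option a × r₁) (Option a × r₁) ℂ)
    (μ : Matrix (((a × v) × b) × (r₁ × r₂)) (((a × v) × b) × (r₁ × r₂)) ℂ)
    {ρ : Matrix ((Option a × r₁) × (b × r₂)) ((Option a × r₁) × (b × r₂)) ℂ}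
    (hρ : ρ = relabel (Equiv.prodProdProdComm (Option a) b r₁ r₂)
      (amp (amp (output a P) b) (r₁ × r₂) μ)) :
    ρ - assemble T (amp (amp (verdict P) b ∘ₗ traceLeft ∘ₗ relabel (Equiv.prodAssoc a v b))
        (r₁ × r₂) μ) =
      conj (valid a r₁ ⊗ₖ (1 : Matrix (b × r₂) (b × r₂) ℂ)) ρ -
        T ⊗ₖ traceLeft (conj (valid a r₁ ⊗ₖ (1 : Matrix (b × r₂) (b × r₂) ℂ)) ρ) := by
  let X : b → r₁ → r₂ → b → r₁ → r₂ → Matrix (a × v) (a × v) ℂ := fun i k₁ k₂ j l₁ l₂ =>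
    μ.submatrix (fun p => ((p, i), (k₁, k₂))) (fun p => ((p, j), (l₁, l₂)))
  have hρX : ∀ o o' i k₁ k₂ j l₁ l₂, ρ ((o, k₁), (i, k₂)) ((o', l₁), (j, l₂)) =
      output a P (X i k₁ k₂ j l₁ l₂) o o' := by
    intros
    rw [hρ]
    rfl
  have hsum : ∀ i k₂ j l₂, traceLeft (conj (valid a r₁ ⊗ₖ (1 : Matrix (b × r₂) (b × r₂) ℂ)) ρ)
      (i, k₂) (j, l₂) = ∑ k₁, verdict P (traceLeft (X i k₁ k₂ j k₁ l₂)) false false := by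
    intro i k₂ j l₂
    simp only [← sum_output_some (a := a), ← hρX]
    simp [traceLeft, conj_valid_apply, Fintype.sum_prod_type, Fintype.sum_option]
    exact Finset.sum_comm
  ext ⟨⟨o, k₁⟩, ⟨i, k₂⟩⟩ ⟨⟨o', l₁⟩, ⟨j, l₂⟩⟩
  have hA : assemble T (amp (amp (verdict P) b ∘ₗ traceLeft ∘ₗ relabel (Equiv.prodAssoc a v b))
        (r₁ × r₂) μ) ((o, k₁), (i, k₂)) ((o', l₁), (j, l₂)) =
      T (o, k₁) (o', l₁) * ∑ k₁, verdict P (traceLeft (X i k₁ k₂ j k₁ l₂)) false false +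
        Matrix.single none none 1 o o' * verdict P (traceLeft (X i k₁ k₂ j l₁ l₂)) true true := rfl
  rw [Matrix.sub_apply, Matrix.sub_apply, hA, conj_valid_apply, Matrix.kroneckerMap_apply, hsum,
    hρX]
  rcases o with _ | o <;> rcases o' with _ | o'
  · simp [output_none_none]
  · simp [output_none_some]
  · simp [output_some_none]
  · simp

/-- The state of `A R₁ B R₂` arranged as a state of `A B` and the reference systems. -/
def joint {x : Type} (A : Matrix (x × r₁) (x × r₁) ℂ) (B : Matrix (b × r₂) (b × r₂) ℂ) :
    Matrix ((x × b) × (r₁ × r₂)) ((x × b) × (r₁ × r₂)) ℂ :=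
  relabel (Equiv.prodProdProdComm x r₁ b r₂) (A ⊗ₖ B)

/-- A product state of `A R₁` and `B R₂`. -/
def jointState {x : Type} [Fintype x] (A : State (x × r₁)) (B : State (b × r₂)) :
    State ((x × b) × (r₁ × r₂)) where
  op := joint A.op B.op
  posSemidef := (IsCP.relabel _).pos (posSemidef_kronecker A.posSemidef B.posSemidef)
  trace_eq_one := (IsTP.relabel _ _).trans (by
    rw [Matrix.trace_kronecker, A.trace_eq_one, B.trace_eq_one, one_mul])

theorem amp_joint {x z : Type} (Φ : Op (x × b) z) (A : Matrix (x × r₁) (x × r₁) ℂ)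
    (B : Matrix (b × r₂) (b × r₂) ℂ) (i j k₁ k₂ l₁ l₂) :
    amp Φ (r₁ × r₂) (joint A B) (i, (k₁, k₂)) (j, (l₁, l₂)) =
      Φ (A.submatrix (fun p => (p, k₁)) (fun p => (p, l₁)) ⊗ₖ
        B.submatrix (fun p => (p, k₂)) (fun p => (p, l₂))) i j := rfl

/-- The state `φ ⊗ ψ_{R₁}`. -/
def replaceState (φ : State a) (ψ : State (a × r₁)) : State (a × r₁) where
  op := φ.op ⊗ₖ traceLeft ψ.op
  posSemidef := posSemidef_kronecker φ.posSemidef (posSemidef_traceLeft ψ.posSemidef)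
  trace_eq_one := by
    rw [Matrix.trace_kronecker, φ.trace_eq_one, trace_traceLeft, ψ.trace_eq_one, one_mul]

/-- Changing only `A` leaves all other systems unchanged, as `statistic_close` requires. -/
theorem joint_marginal (φ : State a) (ψ : State (a × r₁)) (χ : State (b × r₂)) :
    amp traceLeft (r₁ × r₂) (jointState ψ χ).op =
      amp traceLeft (r₁ × r₂) (jointState (replaceState φ ψ) χ).op := by
  ext ⟨i, k₁, k₂⟩ ⟨j, l₁, l₂⟩
  change amp traceLeft (r₁ × r₂) (joint ψ.op χ.op) _ _ =
    amp traceLeft (r₁ × r₂) (joint (φ.op ⊗ₖ traceLeft ψ.op) χ.op) _ _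
  rw [amp_joint, amp_joint, traceLeft_kronecker, traceLeft_kronecker]
  have h : (φ.op ⊗ₖ traceLeft ψ.op).submatrix (fun p => (p, k₁)) (fun p => (p, l₁)) =
      traceLeft ψ.op k₁ l₁ • φ.op := by
    ext p q
    simp [mul_comm]
  rw [h, Matrix.trace_smul, φ.trace_eq_one, smul_eq_mul, mul_one]
  rfl

end

section

variable {a b r₁ r₂ : Type} [Fintype a] [Fintype b] [Fintype r₁] [Fintype r₂]
  [DecidableEq a] [DecidableEq b] [DecidableEq r₁] [DecidableEq r₂]

/-- A pure state. -/
def pureState {x : Type} [Fintype x] (u : x → ℂ) (hu : star u ⬝ᵥ u = 1) : State x :=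
  ⟨Matrix.vecMulVec u (star u), Matrix.posSemidef_vecMulVec_self_star u, by
    rw [Matrix.trace_vecMulVec, dotProduct_comm, hu]⟩

/-- An isometry maps pure states to pure states. The unitarity of the computation is needed here, to
make the ideal output a rank-one projection. -/
theorem exists_amp_target_pure (U : Matrix.unitaryGroup a ℂ) {u : a × r₁ → ℂ}
    (hu : star u ⬝ᵥ u = 1) : ∃ w : Option a × r₁ → ℂ, star w ⬝ᵥ w = 1 ∧ (∀ k, w (none, k) = 0) ∧
      amp (target U) r₁ (Matrix.vecMulVec u (star u)) = Matrix.vecMulVec w (star w) := by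
  set V : Matrix (Option a) a ℂ := Matrix.of fun i j => if i = some j then 1 else 0 with hV
  set K : Matrix (Option a × r₁) (a × r₁) ℂ := (V * (U : Matrix a a ℂ)) ⊗ₖ (1 : Matrix r₁ r₁ ℂ)
    with hK
  have hKK : K.conjTranspose * K = 1 := by
    have hU : (U : Matrix a a ℂ).conjTranspose * (U : Matrix a a ℂ) = 1 :=
      Matrix.mem_unitaryGroup_iff'.1 U.2
    rw [hK, Matrix.conjTranspose_kronecker, ← Matrix.mul_kronecker_mul, Matrix.conjTranspose_mul,
      Matrix.mul_assoc, ← Matrix.mul_assoc V.conjTranspose, embed_isometry, Matrix.one_mul, hU,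
      Matrix.conjTranspose_one, Matrix.one_mul, Matrix.one_kronecker_one]
  refine ⟨K.mulVec u, ?_, ?_, ?_⟩
  · rw [Matrix.star_mulVec, ← Matrix.dotProduct_mulVec, Matrix.mulVec_mulVec, hKK,
      Matrix.one_mulVec, hu]
  · intro k
    have h : ∀ j, K (none, k) j = 0 := by
      intro j
      simp [hK, hV, Matrix.mul_apply]
    simp [Matrix.mulVec, dotProduct, h]
  · have h : amp (target U) r₁ = conj K := by
      ext1 X
      rw [target, amp_comp, LinearMap.comp_apply, embed, amp_conj, amp_conj, conj_apply, conj_apply,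
        conj_apply, hK, ← Matrix.mul_one (1 : Matrix r₁ r₁ ℂ), Matrix.mul_kronecker_mul,
        Matrix.conjTranspose_mul]
      simp only [Matrix.mul_assoc, Matrix.mul_one]
      rfl
    rw [h, conj_apply, Matrix.mul_vecMulVec, Matrix.vecMulVec_mul, ← Matrix.star_mulVec]

theorem valid_projection : IsStarProjection (valid a r₁) := by
  refine ⟨?_, ?_⟩
  · change valid a r₁ * valid a r₁ = _
    rw [valid, Matrix.diagonal_mul_diagonal]
    congr 1
    ext i
    by_cases h : i.1.isSome <;> simp [h]
  · change (valid a r₁).conjTranspose = _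
    rw [valid, Matrix.diagonal_conjTranspose]
    congr 1
    ext i
    by_cases h : i.1.isSome <;> simp [h]

theorem valid_mul_pure {w : Option a × r₁ → ℂ} (hw : ∀ k, w (none, k) = 0) :
    valid a r₁ * Matrix.vecMulVec w (star w) = Matrix.vecMulVec w (star w) := by
  ext ⟨o, k⟩ j
  rw [valid, Matrix.diagonal_mul]
  rcases o with _ | o <;> simp [Matrix.vecMulVec_apply, hw]

theorem valid_mul_err (X : Matrix r₁ r₁ ℂ) :
    valid a r₁ * (Matrix.single none none 1 ⊗ₖ X) = 0 := by
  ext ⟨o, k⟩ j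
  rw [valid, Matrix.diagonal_mul]
  rcases o with _ | o <;> simp

theorem sub_projection {x : Type} [Fintype x] {S T : Matrix x x ℂ} (hS : IsStarProjection S)
    (hT : IsStarProjection T) (hST : S * T = T) : IsStarProjection (S - T) ∧ T * (S - T) = 0 ∧
      (S - T) * T = 0 := by
  have hS1 : S.conjTranspose = S := hS.isSelfAdjoint
  have hS2 : S * S = S := hS.isIdempotentElem
  have hT1 : T.conjTranspose = T := hT.isSelfAdjoint
  have hT2 : T * T = T := hT.isIdempotentElem
  have hTS : T * S = T := by
    have h := congrArg Matrix.conjTranspose hST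
    rwa [Matrix.conjTranspose_mul, hS1, hT1] at h
  refine ⟨⟨?_, ?_⟩, ?_, ?_⟩
  · change (S - T) * (S - T) = _
    rw [sub_mul, mul_sub, mul_sub, hS2, hST, hTS, hT2, sub_self, sub_zero]
  · change (S - T).conjTranspose = _
    rw [Matrix.conjTranspose_sub, hS1, hT1]
  · rw [mul_sub, hTS, hT2, sub_self]
  · rw [sub_mul, hST, hT2, sub_self]

theorem trace_mul_traceRight {x y : Type} [Fintype x] [Fintype y] [DecidableEq y]
    (Q : Matrix x x ℂ) (Y : Matrix (x × y) (x × y) ℂ) :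
    (Q * traceRight Y).trace = ((Q ⊗ₖ (1 : Matrix y y ℂ)) * Y).trace := by
  simp only [Matrix.trace, Matrix.diag_apply, Matrix.mul_apply, traceRight, LinearMap.coe_mk,
    AddHom.coe_mk, Matrix.of_apply, Fintype.sum_prod_type, Matrix.kroneckerMap_apply,
    Matrix.one_apply, mul_ite, mul_one, mul_zero, ite_mul, zero_mul, Finset.sum_ite_eq,
    Finset.mem_univ, if_true, Finset.mul_sum]
  exact Finset.sum_congr rfl fun _ _ => Finset.sum_comm

end

/-! ### Real and ideal runs on pure product inputs -/

section

variable {n : ℕ} {a c m v ℓ b r₁ r₂ : Type} [Fintype a] [Fintype c] [Fintype m] [Fintype v]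
  [Fintype ℓ] [Fintype b] [Fintype r₁] [Fintype r₂] [DecidableEq a] [DecidableEq c]
  [DecidableEq v] [DecidableEq m] [DecidableEq ℓ] [DecidableEq b] [DecidableEq r₁]
  [DecidableEq r₂]

/-- On product states of `A R₁` and `B R₂`, the interaction with the simulator is computed from the
statistics of a run with the dummy input. -/
theorem assemble_simulated (π : Protocol n a c m v) (φ : State a) (m₀ : m) (leak : ℓ)
    (U : Matrix.unitaryGroup a ℂ) (D : Fin n → Channel (c × b) (c × b))
    (ψ : State (a × r₁)) (χ : State (b × r₂)) :
    assemble (amp (target U) r₁ ψ.op)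
        (amp (π.statistic D) (r₁ × r₂) (jointState (replaceState φ ψ) χ).op) =
      relabel (Equiv.prodProdProdComm (Option a) b r₁ r₂)
        (amp (idealRun U leak (π.simulator φ m₀ ℓ) D) (r₁ × r₂) (jointState ψ χ).op) := by
  have hstat : ∀ (e : Bool) (i j : b) k₁ k₂ l₁ l₂,
      amp (π.statistic D) (r₁ × r₂) (joint (φ.op ⊗ₖ traceLeft ψ.op) χ.op)
        ((e, i), (k₁, k₂)) ((e, j), (l₁, l₂)) =
      traceLeft ψ.op k₁ l₁ *
        π.simulated D φ e (χ.op.submatrix (fun p => (p, k₂)) (fun p => (p, l₂))) i j := by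
    intro e i j k₁ k₂ l₁ l₂
    have h : (φ.op ⊗ₖ traceLeft ψ.op).submatrix (fun p => (p, k₁)) (fun p => (p, l₁)) =
        traceLeft ψ.op k₁ l₁ • φ.op := by
      ext p q
      simp [mul_comm]
    rw [amp_joint, h, Matrix.smul_kronecker, map_smul]
    rfl
  have hideal : ∀ o o' (i j : b) k₁ k₂ l₁ l₂,
      amp (idealRun U leak (π.simulator φ m₀ ℓ) D) (r₁ × r₂) (joint ψ.op χ.op)
        ((o, i), (k₁, k₂)) ((o', j), (l₁, l₂)) =
      amp (target U) r₁ ψ.op (o, k₁) (o', l₁) *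
          π.simulated D φ false (χ.op.submatrix (fun p => (p, k₂)) (fun p => (p, l₂))) i j +
        amp (errFlag a a) r₁ ψ.op (o, k₁) (o', l₁) *
          π.simulated D φ true (χ.op.submatrix (fun p => (p, k₂)) (fun p => (p, l₂))) i j := by
    intro o o' i j k₁ k₂ l₁ l₂
    rw [amp_joint, idealRun_simulator, LinearMap.add_apply, LinearMap.comp_apply,
      LinearMap.comp_apply, ampLeft_kronecker, ampLeft_kronecker, amp_kronecker, amp_kronecker]
    rfl
  -- In the accepted branch `R₁` is traced out and contributes `1`; in the error branch its marginal
  -- survives next to the flag.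
  have htr : ∑ k, traceLeft ψ.op k k = 1 := (trace_traceLeft ψ.op).trans ψ.trace_eq_one
  ext ⟨⟨o, k₁⟩, ⟨i, k₂⟩⟩ ⟨⟨o', l₁⟩, ⟨j, l₂⟩⟩
  refine Eq.trans ?_ (hideal o o' i j k₁ k₂ l₁ l₂).symm
  change amp (target U) r₁ ψ.op (o, k₁) (o', l₁) * ∑ k,
      amp (π.statistic D) (r₁ × r₂) (joint (φ.op ⊗ₖ traceLeft ψ.op) χ.op)
        ((false, i), (k, k₂)) ((false, j), (k, l₂)) +
    Matrix.single none none 1 o o' *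
      amp (π.statistic D) (r₁ × r₂) (joint (φ.op ⊗ₖ traceLeft ψ.op) χ.op)
        ((true, i), (k₁, k₂)) ((true, j), (l₁, l₂)) = _
  simp only [hstat, ← Finset.sum_mul, htr, one_mul]
  rw [errFlag, amp_replaceBy, Matrix.kroneckerMap_apply, mul_assoc]

/-- The security of the protocol for pure inputs that are not correlated with the server. -/
theorem run_close_pure (π : Protocol n a c m v) {U : Matrix.unitaryGroup a ℂ} {εbl εind εver : ℝ}
    (hbl : StandAloneBlind π εbl) (hver : StandAloneIndependentVerifiable π U εind εver)
    (φ : State a) (m₀ : m) (leak : ℓ) (D : Fin n → Channel (c × b) (c × b))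
    {u : a × r₁ → ℂ} (hu : star u ⬝ᵥ u = 1) (χ : State (b × r₂)) :
    (amp (π.run D - idealRun U leak (π.simulator φ m₀ ℓ) D) (r₁ × r₂)
        (jointState (pureState u hu) χ).op).IsHermitian ∧
      traceNorm (amp (π.run D - idealRun U leak (π.simulator φ m₀ ℓ) D) (r₁ × r₂)
        (jointState (pureState u hu) χ).op) ≤ 4 * √(2 * εver) + 4 * (εbl + εind) := by
  set ψ := pureState u hu with hψ
  set Ψ := jointState ψ χ with hΨ
  obtain ⟨w, hw, hw0, hT⟩ := exists_amp_target_pure U hu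
  change amp (target U) r₁ ψ.op = _ at hT
  set e := Equiv.prodProdProdComm (Option a) b r₁ r₂ with he
  obtain ⟨ρ, hρ⟩ : ∃ ρ, ρ = relabel e (amp (π.run D) (r₁ × r₂) Ψ.op) := ⟨_, rfl⟩
  have hρpos : ρ.PosSemidef :=
    hρ ▸ (IsCP.relabel e).pos (((π.run_isCP D).amp (r₁ × r₂)).pos Ψ.posSemidef)
  have hρtr : ρ.trace = 1 := by
    rw [hρ, IsTP.relabel, (π.run_isTP D).amp (r₁ × r₂), Ψ.trace_eq_one]
  obtain ⟨hQ, hTQ, hQT⟩ := sub_projection (valid_projection (a := a) (r₁ := r₁))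
    (pure_projection hw) (valid_mul_pure hw0)
  set T := Matrix.vecMulVec w (star w) with hTdef
  set Q := valid a r₁ - T with hQdef
  have hTpos : T.PosSemidef := Matrix.posSemidef_vecMulVec_self_star w
  have hT1 : T.trace = 1 := by rw [hTdef, Matrix.trace_vecMulVec, dotProduct_comm, hw]
  -- invalid outputs are rare
  have hrare : ((Q ⊗ₖ (1 : Matrix (b × r₂) (b × r₂) ℂ)) * ρ).trace.re ≤ 2 * εver := by
    obtain ⟨p, hp0, hp1, hp⟩ := hver.1 b D r₁ r₂ ψ χ
    have hp' : traceDist (traceRight ρ) ((p : ℂ) • T +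
        ((1 - p : ℝ) : ℂ) • (Matrix.single none none 1 ⊗ₖ traceLeft ψ.op)) ≤ εver := by
      rw [hT, errFlag, amp_replaceBy] at hp
      rw [hρ]
      exact hp
    -- The flag is orthogonal to the valid outputs, hence to `T` as well.
    have hQerr : Q * (Matrix.single none none 1 ⊗ₖ traceLeft ψ.op) = 0 := by
      have h : T * (Matrix.single none none 1 ⊗ₖ traceLeft ψ.op) = 0 := by
        have h1 : T * valid a r₁ = T := by
          rw [hQdef, mul_sub, sub_eq_zero] at hTQ
          rw [hTQ, (pure_projection hw).isIdempotentElem]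
        rw [← h1, Matrix.mul_assoc, valid_mul_err, Matrix.mul_zero]
      rw [hQdef, sub_mul, valid_mul_err, h, sub_zero]
    have hherm : (traceRight ρ - ((p : ℂ) • T +
        ((1 - p : ℝ) : ℂ) • (Matrix.single none none 1 ⊗ₖ traceLeft ψ.op))).IsHermitian := by
      refine (IsCP.traceRight.pos hρpos).isHermitian.sub ?_
      refine ((hTpos.smul ?_).add ((posSemidef_kronecker (single_posSemidef none)
        (posSemidef_traceLeft ψ.posSemidef)).smul ?_)).isHermitian
      · exact_mod_cast hp0
      · exact_mod_cast sub_nonneg.2 hp1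
    have hQpos : Q.PosSemidef := by
      have h := projection_compl_posSemidef hQ.one_sub
      rwa [sub_sub_cancel] at h
    -- `Q` annihilates the mixture, so only `ρ` remains. The bound is by the full trace norm, which
    -- is twice the trace distance: hence `2 * εver`.
    have h := trace_effect_le hQpos (projection_compl_posSemidef hQ) hherm
    rw [mul_sub, mul_add, Matrix.mul_smul, Matrix.mul_smul, hQT, hQerr, smul_zero, smul_zero,
      add_zero, sub_zero, trace_mul_traceRight] at h
    unfold traceDist at hp'
    linarith
  -- the run is close to the state assembled from its statistics
  have hclose1 : traceNorm (ρ - assemble T (amp (π.statistic D) (r₁ × r₂) Ψ.op)) ≤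
      4 * √(2 * εver) := by
    have h := assemble_verdict π.accept T (amp (π.measured D) (r₁ × r₂) Ψ.op) hρ
    have h' : amp (π.statistic D) (r₁ × r₂) Ψ.op = amp (amp (verdict π.accept) b ∘ₗ traceLeft ∘ₗ
      relabel (Equiv.prodAssoc a v b)) (r₁ × r₂) (amp (π.measured D) (r₁ × r₂) Ψ.op) := rfl
    have hg := gentle_measurement hw hQ hTQ hρpos hρtr
    rw [← hTdef, show T + Q = valid a r₁ by rw [hQdef, add_sub_cancel]] at hg
    rw [h', h]
    exact hg.trans (by gcongr)
  -- the statistics do not depend on the input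
  set Ψ₀ := jointState (replaceState φ ψ) χ with hΨ₀
  have hsp : ∀ χ : State ((a × b) × (r₁ × r₂)),
      (amp (π.statistic D) (r₁ × r₂) χ.op).PosSemidef :=
    fun χ => ((π.statistic_isCP D).amp (r₁ × r₂)).pos χ.posSemidef
  have hclose2 : traceNorm (assemble T (amp (π.statistic D) (r₁ × r₂) Ψ.op) -
      assemble T (amp (π.statistic D) (r₁ × r₂) Ψ₀.op)) ≤ 4 * (εbl + εind) := by
    have h := statistic_close π hbl hver D Ψ Ψ₀ (joint_marginal φ ψ χ)
    rw [← map_sub]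
    -- `assemble T` is positive and trace-preserving, so it cannot increase the distance of the
    -- statistics.
    refine (traceNorm_map_le (assemble T) (fun _ => assemble_pos hTpos)
      (fun X _ => by rw [assemble_trace hT1]) ((hsp Ψ).isHermitian.sub
        (hsp Ψ₀).isHermitian)).trans ?_
    unfold traceDist at h
    linarith
  have hideal : assemble T (amp (π.statistic D) (r₁ × r₂) Ψ₀.op) = relabel e
      (amp (idealRun U leak (π.simulator φ m₀ ℓ) D) (r₁ × r₂) Ψ.op) := by
    rw [← hT]
    exact assemble_simulated π φ m₀ leak U D ψ χ
  have hZ : amp (π.run D - idealRun U leak (π.simulator φ m₀ ℓ) D) (r₁ × r₂) Ψ.op =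
      relabel e.symm (ρ - assemble T (amp (π.statistic D) (r₁ × r₂) Ψ₀.op)) := by
    rw [hideal, hρ, ← map_sub]
    rfl
  have h1 : (ρ - assemble T (amp (π.statistic D) (r₁ × r₂) Ψ.op)).IsHermitian :=
    hρpos.isHermitian.sub (assemble_pos hTpos (hsp Ψ)).isHermitian
  have h2 : (assemble T (amp (π.statistic D) (r₁ × r₂) Ψ.op) -
      assemble T (amp (π.statistic D) (r₁ × r₂) Ψ₀.op)).IsHermitian :=
    (assemble_pos hTpos (hsp Ψ)).isHermitian.sub (assemble_pos hTpos (hsp Ψ₀)).isHermitian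
  have h3 : (ρ - assemble T (amp (π.statistic D) (r₁ × r₂) Ψ₀.op)).IsHermitian :=
    hρpos.isHermitian.sub (assemble_pos hTpos (hsp Ψ₀)).isHermitian
  rw [hZ]
  refine ⟨h3.submatrix _, ?_⟩
  refine (traceNorm_channel_le (IsCP.relabel _) (IsTP.relabel _) h3).trans ?_
  have h4 := traceNorm_add_le h1 h2
  rw [sub_add_sub_cancel] at h4
  linarith

end

/-! ### Correlated inputs -/

/-- Contraction of a reference system with the vector `w`. -/
def project (x : Type) {q : Type} [DecidableEq x] (w : q → ℂ) : Matrix x (x × q) ℂ :=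
  Matrix.of fun i j => if i = j.1 then star (w j.2) else 0

section

variable {x y q : Type} [Fintype x] [Fintype y] [Fintype q] [DecidableEq x] [DecidableEq y]
  [DecidableEq q]

theorem project_coisometry {w : q → ℂ} (hw : star w ⬝ᵥ w = 1) :
    project x w * (project x w).conjTranspose = 1 := by
  ext i j
  have hw' : ∑ k, star (w k) * w k = 1 := hw
  rcases eq_or_ne i j with rfl | h
  · simpa [project, Matrix.mul_apply, Fintype.sum_prod_type, apply_ite] using hw'
  · simp [project, Matrix.mul_apply, Fintype.sum_prod_type, apply_ite, h]

theorem conj_project (w : q → ℂ) (Y : Matrix (x × q) (x × q) ℂ) :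
    conj (project x w) Y = ∑ k, ∑ l, (star (w k) * w l) •
      Y.submatrix (fun i => (i, k)) (fun i => (i, l)) := by
  ext i j
  simp only [conj_apply, project, Matrix.mul_apply, Matrix.of_apply, Matrix.conjTranspose_apply,
    Fintype.sum_prod_type, ite_mul, zero_mul, apply_ite star, star_star, star_zero, mul_ite,
    mul_zero, Matrix.sum_apply, Matrix.smul_apply, Matrix.submatrix_apply, smul_eq_mul]
  simp only [Finset.sum_comm (s := (Finset.univ : Finset x)), Finset.sum_ite_eq, Finset.mem_univ,
    if_true, Finset.sum_mul]
  rw [Finset.sum_comm]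
  exact Finset.sum_congr rfl fun _ _ => Finset.sum_congr rfl fun _ _ => by ring

/-- Operations on different systems commute: postselecting the reference after the run equals
postselecting it before. -/
theorem conj_project_amp (w : q → ℂ) (Φ : Op x y) (Y : Matrix (x × q) (x × q) ℂ) :
    conj (project y w) (amp Φ q Y) = Φ (conj (project x w) Y) := by
  rw [conj_project, conj_project, map_sum]
  refine Finset.sum_congr rfl fun k _ => ?_
  rw [map_sum]
  refine Finset.sum_congr rfl fun l _ => ?_
  rw [map_smul]
  rfl

end

section

variable {n : ℕ} {a c m v ℓ b : Type} [Fintype a] [Fintype c] [Fintype m] [Fintype v]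
  [Fintype ℓ] [Fintype b] [DecidableEq a] [DecidableEq c]
  [DecidableEq v] [DecidableEq m] [DecidableEq ℓ] [DecidableEq b]

/-- The security for inputs that arise by postselection from pure, uncorrelated ones. -/
theorem run_close_project (π : Protocol n a c m v) {U : Matrix.unitaryGroup a ℂ}
    {εbl εind εver : ℝ}
    (hbl : StandAloneBlind π εbl) (hver : StandAloneIndependentVerifiable π U εind εver)
    (φ : State a) (m₀ : m) (leak : ℓ) (D : Fin n → Channel (c × b) (c × b))
    {r₁ r₂ : Type} [Fintype r₁] [DecidableEq r₁] [Fintype r₂] [DecidableEq r₂]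
    {u : a × r₁ → ℂ} (hu : star u ⬝ᵥ u = 1) (χ : State (b × r₂))
    {w : r₁ × r₂ → ℂ} (hw : star w ⬝ᵥ w = 1) {t : ℝ} (ht : 0 ≤ t)
    {X : Matrix (a × b) (a × b) ℂ}
    (hX : X = (t : ℂ) • conj (project (a × b) w) (jointState (pureState u hu) χ).op) :
    ((π.run D - idealRun U leak (π.simulator φ m₀ ℓ) D) X).IsHermitian ∧
      traceNorm ((π.run D - idealRun U leak (π.simulator φ m₀ ℓ) D) X) ≤
        t * (4 * √(2 * εver) + 4 * (εbl + εind)) := by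
  obtain ⟨h1, h2⟩ := run_close_pure π hbl hver φ m₀ leak D hu χ
  have hh : ∀ {Z : Matrix ((Option a × b) × (r₁ × r₂)) ((Option a × b) × (r₁ × r₂)) ℂ},
      Z.IsHermitian → (conj (project (Option a × b) w) Z).IsHermitian := by
    intro Z hZ
    exact Matrix.isHermitian_mul_mul_conjTranspose _ hZ
  rw [hX, map_smul, ← conj_project_amp]
  refine ⟨?_, (traceNorm_smul_le (hh h1) ht).trans ?_⟩
  · have h := hh h1
    rw [Matrix.IsHermitian, Matrix.conjTranspose_smul, h.eq]
    simp
  · gcongr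
    exact (traceNorm_map_le _ (fun _ => conj_pos _)
      (fun _ => trace_conj_coisometry_le (project_coisometry hw)) h1).trans h2

/-- Teleportation: `R₁` and `R₂` are copies of `A`, the pair `A R₁` is maximally entangled, and `R₂
B` carries `ψ`. Contracting `R₁ R₂` with the same maximally entangled vector returns `ψ` on `A B`
with weight `1 / N²`. -/
theorem run_close_quantum (π : Protocol n a c m v) {U : Matrix.unitaryGroup a ℂ}
    {εbl εind εver : ℝ}
    (hbl : StandAloneBlind π εbl) (hver : StandAloneIndependentVerifiable π U εind εver)
    (φ : State a) (m₀ : m) (leak : ℓ) (D : Fin n → Channel (c × b) (c × b)) (ψ : State (a × b)) :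
    traceNorm (π.run D ψ.op - idealRun U leak (π.simulator φ m₀ ℓ) D ψ.op) ≤
      (Fintype.card a : ℝ) ^ 2 * (4 * √(2 * εver) + 4 * (εbl + εind)) := by
  have hN : (0 : ℝ) < Fintype.card a := by
    have : Nonempty a := by
      by_contra h
      have h' := φ.trace_eq_one
      rw [not_nonempty_iff] at h
      simp [Matrix.trace] at h'
    exact_mod_cast Fintype.card_pos
  let s : ℂ := ((√(Fintype.card a : ℝ))⁻¹ : ℝ)
  have hs : star s = s := Complex.conj_ofReal _
  have hss : s * s = (Fintype.card a : ℂ)⁻¹ := by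
    rw [← Complex.ofReal_mul, ← mul_inv, Real.mul_self_sqrt hN.le]
    simp
  have hN' : (Fintype.card a : ℂ) ≠ 0 := by exact_mod_cast hN.ne'
  let u : a × a → ℂ := fun i => if i.1 = i.2 then s else 0
  have hu : star u ⬝ᵥ u = 1 := by
    simp only [dotProduct, Pi.star_apply, Fintype.sum_prod_type, u, mul_ite, mul_zero,
      Finset.sum_ite_eq, Finset.mem_univ, if_true, hs, hss, Finset.sum_const, Finset.card_univ,
      nsmul_eq_mul, mul_inv_cancel₀ hN']
  let χ : State (b × a) := ψ.map (relabel (Equiv.prodComm a b)) (IsCP.relabel _) (IsTP.relabel _)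
  refine (run_close_project π hbl hver φ m₀ leak D hu χ hu (sq_nonneg (Fintype.card a : ℝ))
    (X := ψ.op) ?_).2
  have hjoint : ∀ i β k l i' β' k' l', (jointState (pureState u hu) χ).op
      ((i, β), (k, l)) ((i', β'), (k', l')) = u (i, k) * star (u (i', k')) *
        ψ.op (l, β) (l', β') := fun _ _ _ _ _ _ _ _ => rfl
  ext ⟨i, β⟩ ⟨i', β'⟩
  rw [conj_project]
  have hu0 : ∀ j k, k ≠ j → u (j, k) = 0 := fun j k h => if_neg h.symm
  have hu1 : ∀ j, u (j, j) = s := fun j => if_pos rfl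
  simp only [Matrix.smul_apply, Matrix.sum_apply, Matrix.submatrix_apply, smul_eq_mul,
    Fintype.sum_prod_type, hjoint]
  rw [Fintype.sum_eq_single i fun k hk => by simp [hu0 i k hk],
    Fintype.sum_eq_single i fun k hk => by simp [hu0 i k hk],
    Fintype.sum_eq_single i' fun k hk => by simp [hu0 i' k hk],
    Fintype.sum_eq_single i' fun k hk => by simp [hu0 i' k hk]]
  simp only [hu1, hs, mul_assoc]
  -- Two entangled vectors, each occurring as ket and bra, give `s ^ 4 = N⁻²`, which the prefactor
  -- `N²` cancels.
  have h4 : s * (s * (s * (s * ψ.op (i, β) (i', β')))) =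
      ((Fintype.card a : ℂ)⁻¹) ^ 2 * ψ.op (i, β) (i', β') := by rw [← hss]; ring
  rw [h4]
  push_cast
  field_simp

/-- Each term of a classical input is, up to its probability, a pure basis state times a server
state. The bounds are averaged with weights `p i` summing to one, so no dimension factor appears. -/
theorem run_close_classical (π : Protocol n a c m v) {U : Matrix.unitaryGroup a ℂ}
    {εbl εind εver : ℝ}
    (hbl : StandAloneBlind π εbl) (hver : StandAloneIndependentVerifiable π U εind εver)
    (φ : State a) (m₀ : m) (leak : ℓ) (D : Fin n → Channel (c × b) (c × b)) (ψ : State (a × b))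
    (hψ : classicalInput b ψ.op) :
    traceNorm (π.run D ψ.op - idealRun U leak (π.simulator φ m₀ ℓ) D ψ.op) ≤
      4 * √(2 * εver) + 4 * (εbl + εind) := by
  let p : a → ℝ := fun i => (block i ψ.op).trace.re
  have hpos : ∀ i, (block i ψ.op).PosSemidef := fun i => (IsCP.block i).pos ψ.posSemidef
  have hp : ∀ i, 0 ≤ p i := fun i => trace_re_nonneg (hpos i)
  have hpsum : ∑ i, p i = 1 := by
    have h : ∑ i, (block i ψ.op).trace = 1 := by
      rw [← ψ.trace_eq_one]
      simp only [Matrix.trace, Fintype.sum_prod_type]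
      rfl
    rw [← Complex.re_sum, h, Complex.one_re]
  let X : a → Matrix (a × b) (a × b) ℂ := fun i => Matrix.single i i 1 ⊗ₖ block i ψ.op
  have hX : ψ.op = ∑ i, X i := by
    ext ⟨i, k⟩ ⟨j, l⟩
    simp only [X, Matrix.sum_apply, Matrix.kroneckerMap_apply, Matrix.single_apply]
    rcases eq_or_ne i j with rfl | h
    · rw [Fintype.sum_eq_single i fun x hx => by simp [hx]]
      simp only [and_self, if_true, one_mul]
      rfl
    · rw [hψ _ _ h, Finset.sum_eq_zero]
      intro x _
      rw [if_neg, zero_mul]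
      rintro ⟨rfl, rfl⟩
      exact h rfl
  have key : ∀ i, ((π.run D - idealRun U leak (π.simulator φ m₀ ℓ) D) (X i)).IsHermitian ∧
      traceNorm ((π.run D - idealRun U leak (π.simulator φ m₀ ℓ) D) (X i)) ≤
        p i * (4 * √(2 * εver) + 4 * (εbl + εind)) := by
    intro i
    -- A block of probability zero cannot be normalized, but it vanishes.
    rcases (hp i).eq_or_lt with h | h
    · have h0 : block i ψ.op = 0 := by
        rw [← (hpos i).trace_eq_zero_iff, trace_eq_re (hpos i)]
        exact_mod_cast h.symm
      have hX0 : X i = 0 := by simp only [X, h0, Matrix.kronecker_zero]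
      rw [hX0, map_zero, ← h, zero_mul]
      exact ⟨Matrix.isHermitian_zero, traceNorm_zero.le⟩
    · have hinv : (0 : ℂ) ≤ ((p i)⁻¹ : ℝ) := by exact_mod_cast (inv_pos.2 h).le
      let χ : State (b × Unit) := State.map
        ⟨(((p i)⁻¹ : ℝ) : ℂ) • block i ψ.op, (hpos i).smul hinv, by
          rw [Matrix.trace_smul, trace_eq_re (hpos i), smul_eq_mul, ← Complex.ofReal_mul,
            inv_mul_cancel₀ h.ne', Complex.ofReal_one]⟩
        (relabel (Equiv.prodPUnit b).symm) (IsCP.relabel _) (IsTP.relabel _)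
      let u : a × Unit → ℂ := fun j => if j.1 = i then 1 else 0
      have hu : star u ⬝ᵥ u = 1 := by
        simp [dotProduct, Fintype.sum_prod_type, u]
      -- No reference is needed: with one-dimensional `R₁` and `R₂` the postselection is trivial.
      let w : Unit × Unit → ℂ := fun _ => 1
      have hw : star w ⬝ᵥ w = 1 := by simp [dotProduct, w]
      refine run_close_project π hbl hver φ m₀ leak D hu χ hw h.le ?_
      have hjoint : ∀ j k j' k' q q', (jointState (pureState u hu) χ).op
          ((j, k), q) ((j', k'), q') = u (j, ()) * star (u (j', ())) *
            ((((p i)⁻¹ : ℝ) : ℂ) * block i ψ.op k k') := fun _ _ _ _ _ _ => rfl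
      have hpc : (p i : ℂ) ≠ 0 := by exact_mod_cast h.ne'
      ext ⟨j, k⟩ ⟨j', k'⟩
      rw [conj_project]
      simp only [Matrix.smul_apply, Matrix.submatrix_apply, smul_eq_mul,
        Fintype.sum_prod_type, hjoint, Finset.univ_unique, Finset.sum_singleton, w, star_one,
        one_mul, X, Matrix.kroneckerMap_apply, Matrix.single_apply, u]
      push_cast
      simp only [eq_comm (a := i)]
      by_cases h1 : j = i <;> by_cases h2 : j' = i <;> simp [h1, h2, hpc]
  have hsum : π.run D ψ.op - idealRun U leak (π.simulator φ m₀ ℓ) D ψ.op =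
      ∑ i, (π.run D - idealRun U leak (π.simulator φ m₀ ℓ) D) (X i) := by
    rw [← map_sum, ← hX, LinearMap.sub_apply]
  rw [hsum]
  refine (traceNorm_sum_le _ _ fun i => (key i).1).trans
    ((Finset.sum_le_sum fun i _ => (key i).2).trans_eq ?_)
  rw [← Finset.sum_mul, hpsum, one_mul]

/-- A simulator that ignores its messages. -/
def trivialSimulator (n : ℕ) (ℓ : Type) [Fintype ℓ] (c₀ : c) : Simulator n c ℓ Unit where
  prep := basisState (true, ())
  start := toChannel (replaceBy (Matrix.single ((), c₀) ((), c₀) 1))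
    (IsCP.replaceBy (single_posSemidef _)) (IsTP.replaceBy (single_trace _))
  step _ := toChannel LinearMap.id IsCP.id IsTP.id
  finish := toChannel (replaceBy (Matrix.single true true 1))
    (IsCP.replaceBy (single_posSemidef _)) (IsTP.replaceBy (single_trace _))

end

end DQC

end

/-! ### Composable security -/

theorem corollary1 {n : ℕ} {a c m v ℓ : Type}
    [Fintype a] [DecidableEq a] [Fintype c] [DecidableEq c] [Fintype m]
    [Fintype v] [DecidableEq v] [Fintype ℓ] [DecidableEq ℓ]
    (π : DQC.Protocol n a c m v) (U : Matrix.unitaryGroup a ℂ) (leak : ℓ)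
    (εbl εind εver : ℝ)
    (hbl : DQC.StandAloneBlind π εbl)
    (hver : DQC.StandAloneIndependentVerifiable π U εind εver) :
    DQC.SecureFor DQC.classicalInput π U leak
        (4 * √(2 * εver) + 2 * εbl + 2 * εind) ∧
      DQC.SecureFor DQC.quantumInput π U leak
        ((4 * √(2 * εver) + 2 * εbl + 2 * εind) * (Fintype.card a : ℝ) ^ 2) := by
  classical
  -- If `a` is empty there is no input state, hence no dummy, but some simulator must still be
  -- supplied; the bounds then hold vacuously.
  rcases isEmpty_or_nonempty a with ha | ⟨⟨a₀⟩⟩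
  · have h : ∀ (r : Type) [Fintype r], DQC.State (a × r) → False := by
      intro r _ ψ
      have h := ψ.trace_eq_one
      simp [Matrix.trace] at h
    exact ⟨⟨Unit, inferInstance, DQC.trivialSimulator n ℓ π.start, fun r _ _ _ ψ _ => (h r ψ).elim⟩,
      ⟨Unit, inferInstance, DQC.trivialSimulator n ℓ π.start, fun r _ _ _ ψ _ => (h r ψ).elim⟩⟩
  -- The memory label `m₀` exists because Alice's first message is a state on `m × c`, which has
  -- trace one.
  · have hm : Nonempty m := by
      by_contra hm
      rw [not_nonempty_iff] at hm
      have h := (π.firstState (DQC.basisState a₀)).trace_eq_one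
      simp [Matrix.trace] at h
    obtain ⟨m₀⟩ := hm
    -- Halving the trace-norm bounds leaves only `2 √(2 εver)`; nonnegativity of the root absorbs
    -- the slack up to the stated `4 √(2 εver)`.
    have hsqrt := Real.sqrt_nonneg (2 * εver)
    refine ⟨⟨m, inferInstance, π.simulator (DQC.basisState a₀) m₀ ℓ, fun r _ _ D ψ hψ => ?_⟩,
      ⟨m, inferInstance, π.simulator (DQC.basisState a₀) m₀ ℓ, fun r _ _ D ψ _ => ?_⟩⟩
    · have h := DQC.run_close_classical π hbl hver (DQC.basisState a₀) m₀ leak D ψ hψ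
      unfold DQC.traceDist
      linarith
    · have h := DQC.run_close_quantum π hbl hver (DQC.basisState a₀) m₀ leak D ψ
      unfold DQC.traceDist
      have h' := mul_nonneg (sq_nonneg (Fintype.card a : ℝ)) hsqrt
      linarith
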